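/- There exist infinite type surfaces whose end spaces are not self-similar although they have a unique maximal type of end; the set of maximal ends can be a singleton, and it can be a Cantor set. Precisely: let a surface be a connected, orientable, second countable Hausdorff $2$-manifold $\Sigma$ without boundary; it is of infinite type if it is not homeomorphic to a compact surface with finitely many points removed. Let $E=E(\Sigma)$ be its space of ends and $E^G\subseteq E$ the set of ends accumulated by genus. Ends $x,y\in E$ are locally homeomorphic if there are clopen neighborhoods $U$ of $x$ and $V$ of $y$ and a homeomorphism $U\to V$ taking $x$ to $y$ and $U\cap E^G$ onto $V\cap E^G$. Write $y\preccurlyeq x$ if every neighborhood of $x$ contains a point locally homeomorphic to $y$; $x$ and $y$ are of the same type if $x\preccurlyeq y$ and $y\preccurlyeq x$; and $x$ is maximal if $x\preccurlyeq y$ implies $y\preccurlyeq x$ for all $y\in E$. The end space is self-similar if for every decomposition $E=E_1\sqcup\dots\sqcup E_n$ ($n\ge 1$) into pairwise disjoint clopen sets, some $E_i$ contains a clopen set $D$ with $(D,D\cap E^G)$ homeomorphic to $(E,E^G)$. **Theorem.** (1) There is an infinite type surface whose end space is not self-similar, whose maximal ends are all of one type, and whose set of maximal ends is a singleton. (2)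 There is an infinite type surface whose end space is not self-similar, whose maximal ends are all of one type, and whose set of maximal ends is homeomorphic to the Cantor set. -/

import Mathlib

open scoped ContDiff Topology

/-! Notions on a space `E` with a distinguished subset `G` (for a surface: the space of ends
and the subset of ends accumulated by genus). Homeomorphisms between subsets of `E` are required to
respect `G`. -/

namespace EndPair

variable {E : Type*} [TopologicalSpace E]

/-- `x` and `y` are locally homeomorphic: some clopen neighbourhood of `x` is homeomorphic, as a
pair (with its intersection with `G`), to a clopen neighbourhood of `y`, with `x` sent to `y`. -/
def LocallyHomeomorphic (G : Set E) (x y : E) : Prop :=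
  ∃ U V : Set E, IsClopen U ∧ IsClopen V ∧ ∃ (hx : x ∈ U) (hy : y ∈ V) (h : U ≃ₜ V),
    h ⟨x, hx⟩ = ⟨y, hy⟩ ∧ ∀ u : U, (u : E) ∈ G ↔ (h u : E) ∈ G

/-- `y ≼ x`: every neighbourhood of `x` contains a point locally homeomorphic to `y`. -/
def Precedes (G : Set E) (y x : E) : Prop :=
  ∀ U ∈ 𝓝 x, ∃ z ∈ U, LocallyHomeomorphic G z y

/-- `x` and `y` are of the same type. -/
def SameType (G : Set E) (x y : E) : Prop :=
  Precedes G x y ∧ Precedes G y x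

/-- The set of maximal points: those `x` for which `x ≼ y` implies `y ≼ x`. -/
def maximalPoints (G : Set E) : Set E :=
  {x | ∀ y, Precedes G x y → Precedes G y x}

/-- There is exactly one type of maximal points. -/
def UniqueMaximalType (G : Set E) : Prop :=
  (maximalPoints G).Nonempty ∧ ∀ x ∈ maximalPoints G, ∀ y ∈ maximalPoints G, SameType G x y

/-- The pair `(E, G)` is self-similar: for every decomposition of `E` into finitely many pairwise
disjoint clopen sets `P 0, …, P n`, some `P i` contains a clopen subset `D` such that
`(D, D ∩ G)` is homeomorphic to `(E, G)`. -/
def SelfSimilar (G : Set E) : Prop :=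
  ∀ (n : ℕ) (P : Fin (n + 1) → Set E), (∀ i, IsClopen (P i)) →
    Pairwise (fun i j => Disjoint (P i) (P j)) → (⋃ i, P i) = Set.univ →
    ∃ i, ∃ D : Set E, D ⊆ P i ∧ IsClopen D ∧ ∃ h : E ≃ₜ D, ∀ x : E, x ∈ G ↔ (h x : E) ∈ G

end EndPair

/-- `X` is a surface: a connected, second countable Hausdorff space, locally
homeomorphic to the plane, and orientable, i.e. it is covered by charts with values in the plane whose
transition maps are smooth with positive Jacobian determinant. (Every topological surface has a
smooth structure, so this is no restriction on orientable topological surfaces.) -/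
structure IsSurface (X : Type*) [TopologicalSpace X] : Prop where
  t2Space : T2Space X
  secondCountable : SecondCountableTopology X
  connected : ConnectedSpace X
  oriented_atlas : ∃ A : Set (OpenPartialHomeomorph X (EuclideanSpace ℝ (Fin 2))),
    (∀ x : X, ∃ φ ∈ A, x ∈ φ.source) ∧
    ∀ φ ∈ A, ∀ ψ ∈ A,
      ContDiffOn ℝ ∞ (φ.symm.trans ψ) (φ.symm.trans ψ).source ∧
      ∀ p ∈ (φ.symm.trans ψ).source, 0 < (fderiv ℝ (φ.symm.trans ψ) p).det

/-- `X` is of finite type: it is homeomorphic to a compact surface with finitely many points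
removed. -/
def IsFiniteType (X : Type*) [TopologicalSpace X] : Prop :=
  ∃ (M : Type) (_ : TopologicalSpace M), IsSurface M ∧ CompactSpace M ∧
    ∃ F : Set M, F.Finite ∧ Nonempty (X ≃ₜ (Fᶜ : Set M))

/-- A surface of infinite type. -/
def IsInfiniteTypeSurface (X : Type*) [TopologicalSpace X] : Prop :=
  IsSurface X ∧ ¬ IsFiniteType X

/-- An end of `X`: a compatible choice of a connected component of the complement of each
compact subset of `X`. -/
structure SurfaceEnd (X : Type*) [TopologicalSpace X] where
  /-- The chosen component of the complement of `K`. -/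
  comp : TopologicalSpace.Compacts X → Set X
  isComponent : ∀ K : TopologicalSpace.Compacts X,
    ∃ x ∈ (K : Set X)ᶜ, comp K = connectedComponentIn (K : Set X)ᶜ x
  compatible : ∀ K L : TopologicalSpace.Compacts X, K ≤ L → comp L ⊆ comp K

/-- The topology of the space of ends, as the inverse limit of the discrete sets of components. -/
instance SurfaceEnd.instTopologicalSpace (X : Type*) [TopologicalSpace X] :
    TopologicalSpace (SurfaceEnd X) :=
  TopologicalSpace.generateFrom
    {U | ∃ (K : TopologicalSpace.Compacts X) (C : Set X), U = {e : SurfaceEnd X | e.comp K = C}}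

/-- A subset `U` of a surface has genus zero: it is homeomorphic to an open subset of the
two-sphere. -/
def HasGenusZero {X : Type*} [TopologicalSpace X] (U : Set X) : Prop :=
  ∃ f : U → Metric.sphere (0 : EuclideanSpace ℝ (Fin 3)) 1, Topology.IsOpenEmbedding f

/-- The ends accumulated by genus: those having no neighbourhood of genus zero. -/
def endsAccumulatedByGenus (X : Type*) [TopologicalSpace X] : Set (SurfaceEnd X) :=
  {e | ∀ K : TopologicalSpace.Compacts X, ¬ HasGenusZero (e.comp K)}

/-!
The surfaces are planar, so no end is accumulated by genus and only the topology of the space of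
ends matters.

*Surfaces.* A nonempty compact totally disconnected subset `K` of a circle in the sphere does not
separate the sphere, not even locally, and therefore the ends of its complement are the points of
`K` (`nonempty_surfaceEnd_homeomorph`, `exists_planar_surface`). The same description of the ends
shows that a surface of finite type has finitely many of them (`IsFiniteType.finite_surfaceEnd`). It
remains to find suitable infinite compact totally disconnected spaces that embed in the line.

*The space of ends.* Let `A` be a set of `b` letters of an alphabet of four letters, with `b = 1` or
`b = 2`. Let `T n` be the union of a Cantor set and of a countable compact space in which a single
point has the maximal Cantor–Bendixson rank `n + 1`, glued at that point, which is called the centre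
of `T n`. The space `Letter.paths b` consists of the infinite words in the four letters, together
with a copy of some `T n`, the piece of `w`, for each nonempty finite word `w`; a sequence of pieces
converges to an infinite word if their words do. If `w` contains a letter outside `A`, then `n` is
the length of `w` (less one); if not, then `n` is chosen such that every number occurs infinitely
often among the prefixes of each infinite word in `A`. All points of the space are coded as
sequences of letters, so the space is a closed set of sequences.

*Maximal points.* Local homeomorphisms preserve the centres and their indices `n`, which are
characterized by means of Cantor–Bendixson ranks (`Letter.isCentre_iff`). Two words of equal length
have homeomorphic cylinders if both or neither of them are words in `A`, and pieces with the same
index are homeomorphic. Hence a copy of each point appears near each infinite word in `A`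
(`Letter.precedes_of_mem_lowPaths`). Conversely, the infinite words in `A` are the only accumulation
points of centres of index `0` (`Letter.isCentreLimit_iff`). So they are the maximal points and are
all of one type, and they form a single point if `b = 1` and a Cantor set if `b = 2`.

*Failure of self-similarity.* Away from the maximal points the centres of each index are finite in
number, and these numbers behave like a measure. A homeomorphism of the whole space onto an open set
of sequences with the same first letter would map the compact set of all paths that start with one
of two letters outside `A` into the part of that open set that lies outside some neighbourhood of
the maximal points. For large `n` the former contains `2 * 4 ^ n` centres of index `n`, but at most
`4 ^ n` are available in the latter (`Letter.not_isOpenEmbedding_of_first_letter`).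
-/

open Filter TopologicalSpace

/-! ### Cantor–Bendixson ranks and centres -/

section LocalInvariants

variable {E E' : Type*} [TopologicalSpace E] [TopologicalSpace E']

/-- `RankLT n x`: the Cantor–Bendixson rank of `x` is defined and less than `n`, i.e. `x` does not
survive to the `n`-th derived set. -/
def RankLT : ℕ → E → Prop
  | 0, _ => False
  | n + 1, x => ∀ᶠ y in 𝓝[≠] x, RankLT n y

/-- `x` has Cantor–Bendixson rank exactly `n`. -/
def RankEq (n : ℕ) (x : E) : Prop := RankLT (n + 1) x ∧ ¬ RankLT n x

/-- `x` is a centre of index `n`: a limit of points of rank `n`, but not of points of rank `n + 1`,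
which is not itself of rank `n`. -/
def IsCentre (n : ℕ) (x : E) : Prop :=
  (∃ᶠ y in 𝓝 x, RankEq n y) ∧ (¬ ∃ᶠ y in 𝓝 x, RankEq (n + 1) y) ∧ ¬ RankEq n x

/-- `x` is an accumulation point of the centres of index `0`. -/
def IsCentreLimit (x : E) : Prop := ∃ᶠ y in 𝓝[≠] x, IsCentre 0 y

theorem RankLT.succ {n : ℕ} : ∀ {x : E}, RankLT n x → RankLT (n + 1) x := by
  induction n with
  | zero => intro x h; exact h.elim
  | succ n ih => intro x h; exact Eventually.mono h fun y hy => ih hy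

theorem RankLT.mono {m n : ℕ} (hmn : m ≤ n) {x : E} (h : RankLT m x) : RankLT n x := by
  induction hmn with
  | refl => exact h
  | step _ ih => exact ih.succ

theorem Topology.IsOpenEmbedding.map_nhdsNE {f : E → E'} (hf : IsOpenEmbedding f) (x : E) :
    map f (𝓝[≠] x) = 𝓝[≠] (f x) := by
  have h : f ⁻¹' {f x} = {x} := by ext y; simp [hf.injective.eq_iff]
  rw [nhdsWithin, nhdsWithin, ← hf.map_nhds_eq, ← h, ← Set.preimage_compl, ← comap_principal,
    Filter.push_pull]

theorem Topology.IsOpenEmbedding.rankLT_iff {f : E → E'} (hf : IsOpenEmbedding f) (n : ℕ) :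
    ∀ x : E, RankLT n (f x) ↔ RankLT n x := by
  induction n with
  | zero => intro x; exact Iff.rfl
  | succ n ih =>
    intro x
    change (∀ᶠ y in 𝓝[≠] (f x), RankLT n y) ↔ ∀ᶠ y in 𝓝[≠] x, RankLT n y
    rw [← hf.map_nhdsNE, eventually_map]
    simp only [ih]

theorem Topology.IsOpenEmbedding.rankEq_iff {f : E → E'} (hf : IsOpenEmbedding f) (n : ℕ) (x : E) :
    RankEq n (f x) ↔ RankEq n x := by
  simp only [RankEq, hf.rankLT_iff]

theorem Topology.IsOpenEmbedding.isCentre_iff {f : E → E'} (hf : IsOpenEmbedding f) (n : ℕ)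
    (x : E) : IsCentre n (f x) ↔ IsCentre n x := by
  simp only [IsCentre, ← hf.map_nhds_eq, frequently_map, hf.rankEq_iff]

theorem Topology.IsOpenEmbedding.isCentreLimit_iff {f : E → E'} (hf : IsOpenEmbedding f) (x : E) :
    IsCentreLimit (f x) ↔ IsCentreLimit x := by
  simp only [IsCentreLimit, ← hf.map_nhdsNE, frequently_map, hf.isCentre_iff]

theorem EndPair.LocallyHomeomorphic.isCentreLimit_iff {G : Set E} {x y : E}
    (h : EndPair.LocallyHomeomorphic G x y) : IsCentreLimit x ↔ IsCentreLimit y := by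
  obtain ⟨U, V, hU, hV, hx, hy, f, hf, -⟩ := h
  have h₁ := hU.isOpen.isOpenEmbedding_subtypeVal.isCentreLimit_iff ⟨x, hx⟩
  have h₂ := hV.isOpen.isOpenEmbedding_subtypeVal.isCentreLimit_iff ⟨y, hy⟩
  have h₃ := f.isOpenEmbedding.isCentreLimit_iff ⟨x, hx⟩
  rw [hf] at h₃
  exact h₁.trans (h₃.symm.trans h₂.symm)

end LocalInvariants

/-! ### The space of paths -/

/-- The letters of the paths that make up the end spaces. A path spells a word in the letters
`word a`, which may go on forever. After a finite word it describes a point of the attached piece: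
`centre n` forever is the centre of the piece, which has index `n`; the letters `rank r`, where `r`
never increases, describe the points of finite rank, and the final value of `r` is the rank; the
letters `cantor c` describe the points of the Cantor set. -/
inductive Letter : Type
  | word (a : Fin 4)
  | centre (n : ℕ)
  | rank (r : ℕ)
  | cantor (c : Bool)

instance : TopologicalSpace Letter := ⊥

instance : DiscreteTopology Letter := ⟨rfl⟩

namespace Letter

/-- The letters `word a` with `a < b`; the sequences of such letters are the maximal points. -/
def IsLow (b : ℕ) (L : Letter) : Prop := ∃ a : Fin 4, (a : ℕ) < b ∧ L = word a

open Classical in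
/-- The index of the piece attached to the word `s 0, …, s i`. Words with a letter that is not low
get `i` as index; along an infinite word of low letters every number occurs infinitely often as an
index, since `i` runs through all pairs. -/
noncomputable def index (b : ℕ) (s : ℕ → Letter) (i : ℕ) : ℕ :=
  if ∀ j ≤ i, (s j).IsLow b then (Nat.unpair i).1 else i

/-- The letter `L` may follow `s 0, …, s i`. -/
def Allowed (b : ℕ) (s : ℕ → Letter) (i : ℕ) (L : Letter) : Prop :=
  match s i, L with
  | word _, word _ => True
  | word _, centre n => n = index b s i
  | centre n, centre m => m = n
  | centre n, rank r => r ≤ n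
  | centre _, cantor _ => True
  | rank r, rank r' => r' ≤ r
  | cantor _, cantor _ => True
  | _, _ => False

/-- The set of all paths, which is to be the space of ends. -/
def paths (b : ℕ) : Set (ℕ → Letter) :=
  {s | (∃ a, s 0 = word a) ∧ ∀ i, Allowed b s i (s (i + 1))}

theorem index_congr {b : ℕ} {s t : ℕ → Letter} {i : ℕ} (h : ∀ j ≤ i, s j = t j) :
    index b s i = index b t i := by
  have : (∀ j ≤ i, (s j).IsLow b) ↔ ∀ j ≤ i, (t j).IsLow b :=
    forall₂_congr fun j hj => by rw [h j hj]
  rw [index, index]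
  split_ifs <;> tauto

theorem allowed_congr {b : ℕ} {s t : ℕ → Letter} {i : ℕ} {L : Letter} (h : ∀ j ≤ i, s j = t j) :
    Allowed b s i L ↔ Allowed b t i L := by
  unfold Allowed
  rw [h i le_rfl, index_congr h]

theorem allowed_self (b : ℕ) {s : ℕ → Letter} {i : ℕ} {L : Letter} (h : s i = L) :
    Allowed b s i L := by
  unfold Allowed
  rw [h]
  cases L <;> simp

/-- The sequence that follows `s` up to position `M` and is constantly `L` afterwards. -/
def cut (s : ℕ → Letter) (M : ℕ) (L : Letter) : ℕ → Letter := fun i => if i ≤ M then s i else L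

theorem cut_of_le {s : ℕ → Letter} {M : ℕ} {L : Letter} {i : ℕ} (h : i ≤ M) :
    cut s M L i = s i := if_pos h

theorem cut_of_lt {s : ℕ → Letter} {M : ℕ} {L : Letter} {i : ℕ} (h : M < i) :
    cut s M L i = L := if_neg h.not_ge

theorem cut_mem {b : ℕ} {s : ℕ → Letter} (hs : s ∈ paths b) {M : ℕ} {L : Letter}
    (hL : Allowed b s M L) : cut s M L ∈ paths b := by
  refine ⟨by rw [cut_of_le (Nat.zero_le M)]; exact hs.1, fun i => ?_⟩
  rcases lt_trichotomy i M with h | rfl | h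
  · rw [cut_of_le (show i + 1 ≤ M from h)]
    exact (allowed_congr fun j hj => cut_of_le (hj.trans h.le)).2 (hs.2 i)
  · rw [cut_of_lt (Nat.lt_succ_self i)]
    exact (allowed_congr fun j hj => cut_of_le hj).2 hL
  · rw [cut_of_lt (h.trans (Nat.lt_succ_self i))]
    exact allowed_self b (cut_of_lt h)

section Steps

variable {b : ℕ} {s : ℕ → Letter}

theorem word_of_word_succ (hs : s ∈ paths b) {i : ℕ} (h : ∃ a, s (i + 1) = word a) :
    ∃ a, s i = word a := by
  obtain ⟨a, ha⟩ := h
  have := hs.2 i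
  rw [ha] at this
  unfold Allowed at this
  split at this <;> simp_all

theorem word_of_le (hs : s ∈ paths b) {i j : ℕ} (hij : i ≤ j) (h : ∃ a, s j = word a) :
    ∃ a, s i = word a := by
  induction hij with
  | refl => exact h
  | step _ ih => exact ih (word_of_word_succ hs h)

theorem cantor_of_ge (hs : s ∈ paths b) {i j : ℕ} (hij : i ≤ j) (h : ∃ c, s i = cantor c) :
    ∃ c, s j = cantor c := by
  induction hij with
  | refl => exact h
  | @step j _ ih =>
    obtain ⟨c, hc⟩ := ih
    have := hs.2 j
    unfold Allowed at this
    split at this <;> simp_all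

theorem rank_of_ge (hs : s ∈ paths b) {i j r : ℕ} (hij : i ≤ j) (h : s i = rank r) :
    ∃ r' ≤ r, s j = rank r' := by
  induction hij with
  | refl => exact ⟨r, le_rfl, h⟩
  | @step j _ ih =>
    obtain ⟨r', hr', hc⟩ := ih
    have := hs.2 j
    unfold Allowed at this
    split at this <;> simp_all
    omega

theorem centre_of_ge (hs : s ∈ paths b) {i j n : ℕ} (hij : i ≤ j) (h : s i = centre n) :
    s j = centre n ∨ (∃ r ≤ n, s j = rank r) ∨ ∃ c, s j = cantor c := by
  induction hij with
  | refl => exact Or.inl h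
  | @step j _ ih =>
    have := hs.2 j
    unfold Allowed at this
    split at this <;> simp_all
    omega

/-- An index is at most the position at which it occurs. -/
theorem index_le (b : ℕ) (s : ℕ → Letter) (i : ℕ) : index b s i ≤ i := by
  unfold index
  split_ifs
  · exact Nat.unpair_left_le i
  · exact le_rfl

/-- The path `s` is eventually constant with value `L`. -/
def EndsIn (s : ℕ → Letter) (L : Letter) : Prop := ∃ N, ∀ i ≥ N, s i = L

theorem EndsIn.unique {L L' : Letter} (h : EndsIn s L) (h' : EndsIn s L') : L = L' := by
  obtain ⟨N, hN⟩ := h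
  obtain ⟨N', hN'⟩ := h'
  rw [← hN (max N N') (le_max_left _ _), hN' _ (le_max_right _ _)]

theorem endsIn_cut {M : ℕ} {L : Letter} : EndsIn (cut s M L) L :=
  ⟨M + 1, fun _ hi => cut_of_lt hi⟩

/-- Every path is an infinite word, eventually constant with value `centre n` or `rank r`, or it
contains a letter `cantor c`. -/
theorem paths_cases (hs : s ∈ paths b) :
    (∀ i, ∃ a, s i = word a) ∨ (∃ n, EndsIn s (centre n)) ∨ (∃ r, EndsIn s (rank r)) ∨
      ∃ N c, s N = cantor c := by
  classical
  by_cases hc : ∃ N c, s N = cantor c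
  · exact Or.inr (Or.inr (Or.inr hc))
  push Not at hc
  by_cases hr : ∃ r N, s N = rank r
  · obtain ⟨N, hN⟩ := Nat.find_spec hr
    refine Or.inr (Or.inr (Or.inl ⟨Nat.find hr, N, fun i hi => ?_⟩))
    obtain ⟨r', hr', h⟩ := rank_of_ge hs hi hN
    rwa [← le_antisymm hr' (Nat.find_min' hr ⟨i, h⟩)]
  push Not at hr
  by_cases hn : ∃ n N, s N = centre n
  · obtain ⟨n, N, hN⟩ := hn
    refine Or.inr (Or.inl ⟨n, N, fun i hi => ?_⟩)
    rcases centre_of_ge hs hi hN with h | ⟨r, -, h⟩ | ⟨c, h⟩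
    · exact h
    · exact (hr _ _ h).elim
    · exact (hc _ _ h).elim
  push Not at hn
  refine Or.inl fun i => ?_
  cases h : s i with
  | word a => exact ⟨a, rfl⟩
  | centre n => exact (hn _ _ h).elim
  | rank r => exact (hr _ _ h).elim
  | cantor c => exact (hc _ _ h).elim

end Steps

/-! ### The topology of the space of paths -/

section Topology

variable {b : ℕ}

theorem eventually_nhds_paths {s : paths b} {P : paths b → Prop} :
    (∀ᶠ t in 𝓝 s, P t) ↔ ∃ M, ∀ t : paths b, (∀ i ≤ M, t.1 i = s.1 i) → P t := by
  constructor
  · intro h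
    rw [nhds_subtype_eq_comap, eventually_comap] at h
    obtain ⟨_, ⟨x, n, rfl⟩, hx, hn⟩ :=
      (PiNat.isTopologicalBasis_cylinders (fun _ : ℕ => Letter)).mem_nhds_iff.1 h
    refine ⟨n, fun t ht => hn (a := t.1) ?_ t rfl⟩
    exact fun i hi => (ht i hi.le).trans (hx i hi)
  · rintro ⟨M, hM⟩
    have : ∀ᶠ t in 𝓝 s, t.1 ∈ PiNat.cylinder s.1 (M + 1) :=
      ((PiNat.isOpen_cylinder _ s.1 (M + 1)).preimage continuous_subtype_val).mem_nhds
        (PiNat.self_mem_cylinder s.1 (M + 1))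
    exact this.mono fun t ht => hM t fun i hi => ht i (Nat.lt_succ_of_le hi)

theorem frequently_nhds_paths {s : paths b} {P : paths b → Prop} :
    (∃ᶠ t in 𝓝 s, P t) ↔ ∀ M, ∃ t : paths b, (∀ i ≤ M, t.1 i = s.1 i) ∧ P t := by
  rw [Filter.Frequently, eventually_nhds_paths]
  push Not
  rfl

theorem eventually_nhdsNE_paths {s : paths b} {P : paths b → Prop} :
    (∀ᶠ t in 𝓝[≠] s, P t) ↔ ∃ M, ∀ t : paths b, (∀ i ≤ M, t.1 i = s.1 i) → t ≠ s → P t := by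
  rw [eventually_nhdsWithin_iff, eventually_nhds_paths]
  rfl

theorem frequently_nhdsNE_paths {s : paths b} {P : paths b → Prop} :
    (∃ᶠ t in 𝓝[≠] s, P t) ↔ ∀ M, ∃ t : paths b, (∀ i ≤ M, t.1 i = s.1 i) ∧ t ≠ s ∧ P t := by
  rw [Filter.Frequently, eventually_nhdsNE_paths]
  push Not
  rfl

/-- A condition on finitely many letters defines a clopen set. -/
theorem isClopen_setOf_prefix {n : ℕ} (P : (ℕ → Letter) → Prop)
    (hP : ∀ s t : ℕ → Letter, (∀ i ≤ n, s i = t i) → P s → P t) :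
    IsClopen {s : ℕ → Letter | P s} := by
  have key : ∀ Q : (ℕ → Letter) → Prop, (∀ s t : ℕ → Letter, (∀ i ≤ n, s i = t i) → Q s → Q t) →
      IsOpen {s : ℕ → Letter | Q s} := by
    intro Q hQ
    refine isOpen_iff_mem_nhds.2 fun s hs => ?_
    refine Filter.mem_of_superset ((PiNat.isOpen_cylinder _ s (n + 1)).mem_nhds
      (PiNat.self_mem_cylinder s (n + 1))) fun t ht => ?_
    exact hQ s t (fun i hi => (ht i (Nat.lt_succ_of_le hi)).symm) hs
  refine ⟨⟨?_⟩, key P hP⟩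
  exact key (fun s => ¬ P s) fun s t h hs ht => hs (hP t s (fun i hi => (h i hi).symm) ht)

theorem continuous_letter (i : ℕ) : Continuous fun s : paths b => s.1 i :=
  (continuous_apply i).comp continuous_subtype_val

theorem isClosed_paths (b : ℕ) : IsClosed (paths b) := by
  have : paths b = {s | ∃ a, s 0 = word a} ∩ ⋂ i, {s | Allowed b s i (s (i + 1))} := by
    ext s; simp [paths]
  rw [this]
  refine IsClosed.inter (isClopen_setOf_prefix (n := 0) _ ?_).isClosed
    (isClosed_iInter fun i => (isClopen_setOf_prefix (n := i + 1) _ ?_).isClosed)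
  · intro s t h; rw [h 0 le_rfl]; exact id
  · intro s t h hs
    rw [← h (i + 1) le_rfl]
    exact (allowed_congr fun j hj => h j (hj.trans (Nat.le_succ i))).1 hs

/-- The letters that a path can have at position `i`: a finite set. -/
def lettersAt (i : ℕ) : Set Letter :=
  Set.range word ∪ centre '' Set.Iic i ∪ rank '' Set.Iic i ∪ Set.range cantor

theorem finite_lettersAt (i : ℕ) : (lettersAt i).Finite :=
  (((Set.finite_range _).union ((Set.finite_Iic i).image _)).union
    ((Set.finite_Iic i).image _)).union (Set.finite_range _)

theorem mem_lettersAt {s : ℕ → Letter} (hs : s ∈ paths b) (i : ℕ) : s i ∈ lettersAt i := by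
  induction i with
  | zero =>
    obtain ⟨a, ha⟩ := hs.1
    rw [ha]
    exact Or.inl (Or.inl (Or.inl ⟨a, rfl⟩))
  | succ i ih =>
    have h := hs.2 i
    have hi := index_le b s i
    unfold Allowed at h
    simp only [lettersAt, Set.mem_union, Set.mem_range, Set.mem_image, Set.mem_Iic] at ih ⊢
    split at h <;> simp_all <;> omega

theorem isCompact_paths (b : ℕ) : IsCompact (paths b) :=
  (isCompact_univ_pi fun i => (finite_lettersAt i).isCompact).of_isClosed_subset (isClosed_paths b)
    fun _ hs i _ => mem_lettersAt hs i

instance : CompactSpace (paths b) := isCompact_iff_compactSpace.1 (isCompact_paths b)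

end Topology

/-! ### Ranks and centres in the space of paths -/

section Ranks

variable {b : ℕ}

theorem rankEq_of_endsIn_rank (r : ℕ) :
    ∀ s : paths b, EndsIn s.1 (rank r) → RankEq r s := by
  induction r using Nat.strong_induction_on with
  | _ r ih =>
    intro s ⟨N, hN⟩
    constructor
    · refine eventually_nhdsNE_paths.2 ⟨N, fun t ht hts => ?_⟩
      have hr : ∀ i ≥ N, ∃ r' ≤ r, t.1 i = rank r' := fun i hi =>
        rank_of_ge t.2 hi ((ht N le_rfl).trans (hN N le_rfl))
      -- the final rank of `t` is less than `r`, as otherwise `t` would be equal to `s`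
      obtain ⟨i, hi, r', hr', hti⟩ : ∃ i ≥ N, ∃ r' < r, t.1 i = rank r' := by
        by_contra! hcon
        refine hts (Subtype.ext (funext fun i => ?_))
        rcases le_total i N with h | h
        · exact ht i h
        · obtain ⟨r', hr', h'⟩ := hr i h
          rcases hr'.lt_or_eq with h'' | rfl
          · exact (hcon i h r' h'' h').elim
          · rw [h', hN i h]
      rcases paths_cases t.2 with h | ⟨n, M, hM⟩ | ⟨r'', M, hM⟩ | ⟨M, c, hM⟩
      · obtain ⟨a, ha⟩ := h i
        simp [hti] at ha
      · obtain ⟨r₁, -, h₁⟩ := rank_of_ge t.2 (le_max_left i M) hti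
        simp [hM _ (le_max_right i M)] at h₁
      · obtain ⟨r₁, hr₁, h₁⟩ := rank_of_ge t.2 (le_max_left i M) hti
        rw [hM _ (le_max_right i M)] at h₁
        obtain rfl : r'' = r₁ := by simpa using h₁
        have hlt : r'' < r := hr₁.trans_lt hr'
        exact (ih r'' hlt t ⟨M, hM⟩).1.mono hlt
      · obtain ⟨r₁, -, h₁⟩ := rank_of_ge t.2 (le_max_left i M) hti
        obtain ⟨c, hc⟩ := cantor_of_ge t.2 (le_max_right i M) ⟨c, hM⟩
        simp [hc] at h₁
    · cases r with
      | zero => exact id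
      | succ r =>
        change ¬ ∀ᶠ t in 𝓝[≠] s, RankLT r t
        rw [Filter.not_eventually, frequently_nhdsNE_paths]
        intro M
        have hM : s.1 (max M N) = rank (r + 1) := hN _ (le_max_right _ _)
        have hmem : cut s.1 (max M N) (rank r) ∈ paths b :=
          cut_mem s.2 (by unfold Allowed; simp [hM])
        refine ⟨⟨_, hmem⟩, fun i hi => cut_of_le (hi.trans (le_max_left _ _)), fun h => ?_,
          (ih r (Nat.lt_succ_self r) ⟨_, hmem⟩ endsIn_cut).2⟩
        have h' := congrFun (congrArg Subtype.val h) (max M N + 1)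
        rw [hN _ (by omega)] at h'
        simp [cut_of_lt] at h'

theorem not_rankLT_of_cantor {N : ℕ} (n : ℕ) :
    ∀ s : paths b, (∃ c, s.1 N = cantor c) → ¬ RankLT n s := by
  induction n with
  | zero => exact fun _ _ => id
  | succ n ih =>
    intro s hs
    change ¬ ∀ᶠ t in 𝓝[≠] s, RankLT n t
    rw [Filter.not_eventually, frequently_nhdsNE_paths]
    intro M
    obtain ⟨c, hc⟩ := cantor_of_ge s.2 (le_max_right M N) hs
    obtain ⟨c', hc'⟩ := cantor_of_ge s.2 (Nat.le_succ (max M N)) ⟨c, hc⟩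
    have hmem : cut s.1 (max M N) (cantor (!c')) ∈ paths b :=
      cut_mem s.2 (by unfold Allowed; simp [hc])
    refine ⟨⟨_, hmem⟩, fun i hi => cut_of_le (hi.trans (le_max_left _ _)), fun h => ?_,
      ih ⟨_, hmem⟩ ?_⟩
    · have h' := congrFun (congrArg Subtype.val h) (max M N + 1)
      rw [hc'] at h'
      simp [cut_of_lt] at h'
    · simpa only [cut_of_le (le_max_right M N)] using hs

theorem not_rankLT_of_endsIn_centre {n : ℕ} (m : ℕ) (s : paths b) (hs : EndsIn s.1 (centre n)) :
    ¬ RankLT m s := by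
  obtain ⟨N, hN⟩ := hs
  cases m with
  | zero => exact id
  | succ m =>
    change ¬ ∀ᶠ t in 𝓝[≠] s, RankLT m t
    rw [Filter.not_eventually, frequently_nhdsNE_paths]
    intro M
    have hM : s.1 (max M N) = centre n := hN _ (le_max_right _ _)
    have hmem : cut s.1 (max M N) (cantor true) ∈ paths b :=
      cut_mem s.2 (by unfold Allowed; simp [hM])
    refine ⟨⟨_, hmem⟩, fun i hi => cut_of_le (hi.trans (le_max_left _ _)), fun h => ?_,
      not_rankLT_of_cantor (N := max M N + 1) m ⟨_, hmem⟩
        ⟨true, cut_of_lt (Nat.lt_succ_self _)⟩⟩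
    have h' := congrFun (congrArg Subtype.val h) (max M N + 1)
    rw [hN _ (by omega)] at h'
    simp [cut_of_lt] at h'

/-- A path through `centre n` or `rank n` can be continued to a path of any rank `m ≤ n`. -/
theorem exists_rankEq {m M : ℕ} (s : paths b)
    (hM : ∃ n, m ≤ n ∧ (s.1 M = centre n ∨ s.1 M = rank n)) :
    ∃ t : paths b, (∀ i ≤ M, t.1 i = s.1 i) ∧ RankEq m t := by
  obtain ⟨n, hmn, hn⟩ := hM
  have hmem : cut s.1 M (rank m) ∈ paths b :=
    cut_mem s.2 (by unfold Allowed; rcases hn with h | h <;> simp [h, hmn])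
  exact ⟨⟨_, hmem⟩, fun i hi => cut_of_le hi, rankEq_of_endsIn_rank m ⟨_, hmem⟩ endsIn_cut⟩

/-- Near an infinite word there are points of all ranks. -/
theorem frequently_rankEq_of_word (hb : b ≤ 2) (m : ℕ) (s : paths b)
    (hs : ∀ i, ∃ a, s.1 i = word a) : ∃ᶠ t in 𝓝 s, RankEq m t := by
  rw [frequently_nhds_paths]
  intro M'
  set M := max M' m with hMdef
  obtain ⟨a, ha⟩ := hs M
  -- append the letter `word 2`, which is not low, and then the centre of large index `M + 1`
  have h₁ : cut s.1 M (word 2) ∈ paths b := cut_mem s.2 (by unfold Allowed; simp [ha])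
  have e₁ : cut s.1 M (word 2) (M + 1) = word 2 := cut_of_lt (Nat.lt_succ_self M)
  have hidx : index b (cut s.1 M (word 2)) (M + 1) = M + 1 := by
    refine if_neg fun h => ?_
    obtain ⟨a', ha', h'⟩ := h (M + 1) le_rfl
    rw [e₁, word.injEq] at h'
    subst h'
    simp at ha'
    omega
  have h₂ : cut (cut s.1 M (word 2)) (M + 1) (centre (M + 1)) ∈ paths b :=
    cut_mem h₁ (by unfold Allowed; simp [e₁, hidx])
  obtain ⟨t, ht, htm⟩ := exists_rankEq (m := m) (M := M + 2) ⟨_, h₂⟩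
    ⟨M + 1, by omega, Or.inl (cut_of_lt (Nat.lt_succ_self (M + 1)))⟩
  refine ⟨t, fun i hi => ?_, htm⟩
  rw [ht i (by omega)]
  exact (cut_of_le (by omega)).trans (cut_of_le (by omega))

theorem not_rankEq_of_endsIn_rank {r m : ℕ} (h : r ≠ m) (s : paths b) (hs : EndsIn s.1 (rank r)) :
    ¬ RankEq m s := by
  intro hm
  have hr := rankEq_of_endsIn_rank r s hs
  rcases lt_or_gt_of_ne h with h | h
  · exact hm.2 (hr.1.mono h)
  · exact hr.2 (hm.1.mono h)

theorem frequently_rankEq_of_endsIn_centre {n m : ℕ} (s : paths b) (hs : EndsIn s.1 (centre n)) :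
    (∃ᶠ t in 𝓝 s, RankEq m t) ↔ m ≤ n := by
  obtain ⟨N, hN⟩ := hs
  constructor
  · intro h
    by_contra! hlt
    refine h (eventually_nhds_paths.2 ⟨N, fun t ht => ?_⟩)
    have htN : t.1 N = centre n := (ht N le_rfl).trans (hN N le_rfl)
    rcases paths_cases t.2 with h | ⟨n', h⟩ | ⟨r, M, hM⟩ | ⟨M, c, hM⟩
    · obtain ⟨a, ha⟩ := h N
      simp [htN] at ha
    · exact fun h' => not_rankLT_of_endsIn_centre _ t h h'.1
    · rcases centre_of_ge t.2 (le_max_left N M) htN with h | ⟨r', hr', h⟩ | ⟨c, h⟩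
      · simp [hM _ (le_max_right N M)] at h
      · rw [hM _ (le_max_right N M), rank.injEq] at h
        exact not_rankEq_of_endsIn_rank (by omega) t ⟨M, hM⟩
      · simp [hM _ (le_max_right N M)] at h
    · exact fun h' => not_rankLT_of_cantor _ t ⟨c, hM⟩ h'.1
  · intro h
    rw [frequently_nhds_paths]
    intro M
    obtain ⟨t, ht, htm⟩ := exists_rankEq (m := m) (M := max M N) s
      ⟨n, h, Or.inl (hN _ (le_max_right _ _))⟩
    exact ⟨t, fun i hi => ht i (hi.trans (le_max_left _ _)), htm⟩

theorem frequently_rankEq_of_endsIn_rank {n m : ℕ} (s : paths b) (hs : EndsIn s.1 (rank n)) :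
    (∃ᶠ t in 𝓝 s, RankEq m t) ↔ m ≤ n := by
  obtain ⟨N, hN⟩ := hs
  constructor
  · intro h
    by_contra! hlt
    refine h (eventually_nhds_paths.2 ⟨N, fun t ht => ?_⟩)
    have htN : t.1 N = rank n := (ht N le_rfl).trans (hN N le_rfl)
    rcases paths_cases t.2 with h | ⟨n', M, hM⟩ | ⟨r, M, hM⟩ | ⟨M, c, hM⟩
    · obtain ⟨a, ha⟩ := h N
      simp [htN] at ha
    · obtain ⟨r', hr', h⟩ := rank_of_ge t.2 (le_max_left N M) htN
      simp [hM _ (le_max_right N M)] at h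
    · obtain ⟨r', hr', h⟩ := rank_of_ge t.2 (le_max_left N M) htN
      rw [hM _ (le_max_right N M), rank.injEq] at h
      exact not_rankEq_of_endsIn_rank (by omega) t ⟨M, hM⟩
    · exact fun h' => not_rankLT_of_cantor _ t ⟨c, hM⟩ h'.1
  · intro h
    rw [frequently_nhds_paths]
    intro M
    obtain ⟨t, ht, htm⟩ := exists_rankEq (m := m) (M := max M N) s
      ⟨n, h, Or.inr (hN _ (le_max_right _ _))⟩
    exact ⟨t, fun i hi => ht i (hi.trans (le_max_left _ _)), htm⟩

/-- The centres of index `n` are the paths that end in `centre n`. -/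
theorem isCentre_iff (hb : b ≤ 2) {n : ℕ} {s : paths b} :
    IsCentre n s ↔ EndsIn s.1 (centre n) := by
  constructor
  · rintro ⟨h₁, h₂, h₃⟩
    rcases paths_cases s.2 with h | ⟨m, h⟩ | ⟨r, h⟩ | ⟨N, c, h⟩
    · exact (h₂ (frequently_rankEq_of_word hb _ s h)).elim
    · rw [frequently_rankEq_of_endsIn_centre s h] at h₁ h₂
      obtain rfl : n = m := by omega
      exact h
    · rw [frequently_rankEq_of_endsIn_rank s h] at h₁ h₂
      obtain rfl : n = r := by omega
      exact (h₃ (rankEq_of_endsIn_rank n s h)).elim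
    · refine (h₁ (eventually_nhds_paths.2 ⟨N, fun t ht h' => ?_⟩)).elim
      exact not_rankLT_of_cantor _ t ⟨c, (ht N le_rfl).trans h⟩ h'.1
  · intro h
    refine ⟨(frequently_rankEq_of_endsIn_centre s h).2 le_rfl, ?_,
      fun h' => not_rankLT_of_endsIn_centre _ s h h'.1⟩
    rw [frequently_rankEq_of_endsIn_centre s h]
    omega

/-- The infinite words in low letters. -/
def lowPaths (b : ℕ) : Set (paths b) := {s | ∀ i, (s.1 i).IsLow b}

/-- A path that ends in a centre: the word before it, and the index of the centre. -/
theorem EndsIn.exists_index {n : ℕ} {s : ℕ → Letter} (hs : s ∈ paths b)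
    (h : EndsIn s (centre n)) :
    ∃ k, (∀ i ≤ k, ∃ a, s i = word a) ∧ (∀ i > k, s i = centre n) ∧ n = index b s k := by
  classical
  let p : ℕ → Prop := fun N => ∀ i ≥ N, s i = centre n
  have hp : ∃ N, p N := h
  obtain ⟨a₀, ha₀⟩ := hs.1
  obtain ⟨k, hk⟩ : ∃ k, Nat.find hp = k + 1 := by
    refine Nat.exists_eq_succ_of_ne_zero fun h0 => ?_
    have := Nat.find_spec hp 0 (by omega)
    simp [ha₀] at this
  have hspec : ∀ i > k, s i = centre n := fun i hi => Nat.find_spec hp i (by omega)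
  have hmin : s k ≠ centre n := by
    intro hsk
    refine Nat.find_min hp (m := k) (by omega) fun i hi => ?_
    rcases Nat.lt_or_eq_of_le hi with h' | rfl
    · exact hspec i h'
    · exact hsk
  have hst := hs.2 k
  rw [hspec (k + 1) (Nat.lt_succ_self k)] at hst
  unfold Allowed at hst
  refine ⟨k, fun i hi => word_of_le hs hi ?_, hspec, ?_⟩ <;>
    split at hst <;> simp_all

/-- The accumulation points of centres of index `0` are exactly the infinite words in low
letters. -/
theorem isCentreLimit_iff (hb : b ≤ 2) {s : paths b} : IsCentreLimit s ↔ s ∈ lowPaths b := by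
  unfold IsCentreLimit
  simp only [isCentre_iff hb]
  constructor
  · intro h
    rw [frequently_nhdsNE_paths] at h
    rcases paths_cases s.2 with hs | ⟨m, N, hs⟩ | ⟨r, N, hs⟩ | ⟨N, c, hs⟩
    · intro j
      by_contra hj
      obtain ⟨t, ht, -, h⟩ := h (j + 1)
      obtain ⟨k, -, hk, hidx⟩ := h.exists_index t.2
      have hjk : j + 1 ≤ k := by
        by_contra! hlt
        obtain ⟨a, ha⟩ := hs (j + 1)
        simp [← ht (j + 1) le_rfl, hk _ hlt] at ha
      rw [index, if_neg] at hidx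
      · omega
      · intro h'
        exact hj (ht j (by omega) ▸ h' j (by omega))
    · obtain ⟨t, ht, hts, k, hk⟩ := h N
      refine (hts (Subtype.ext (funext fun i => ?_))).elim
      obtain ⟨k, h₁, h₂, -⟩ := EndsIn.exists_index t.2 ⟨k, hk⟩
      have hkN : k < N := by
        by_contra! hle
        obtain ⟨a, ha⟩ := h₁ N hle
        simp [ht N le_rfl, hs N le_rfl] at ha
      rcases le_total i N with hi | hi
      · exact ht i hi
      · rw [h₂ i (by omega), hs i hi, ← hs N le_rfl, ← ht N le_rfl, h₂ N hkN]
    · obtain ⟨t, ht, hts, k, hk⟩ := h N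
      obtain ⟨r', -, h'⟩ := rank_of_ge t.2 (le_max_left N k) ((ht N le_rfl).trans (hs N le_rfl))
      simp [hk _ (le_max_right N k)] at h'
    · obtain ⟨t, ht, hts, k, hk⟩ := h N
      obtain ⟨r', h'⟩ := cantor_of_ge t.2 (le_max_left N k) ⟨c, (ht N le_rfl).trans hs⟩
      simp [hk _ (le_max_right N k)] at h'
  · intro hs
    rw [frequently_nhdsNE_paths]
    intro M
    obtain ⟨a, -, ha⟩ := hs (Nat.pair 0 M)
    have hidx : index b s.1 (Nat.pair 0 M) = 0 := by
      rw [index, if_pos fun j _ => hs j, Nat.unpair_pair]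
    have hmem : cut s.1 (Nat.pair 0 M) (centre 0) ∈ paths b :=
      cut_mem s.2 (by unfold Allowed; simp [ha, hidx])
    refine ⟨⟨_, hmem⟩, fun i hi => cut_of_le (hi.trans (Nat.right_le_pair 0 M)), fun h => ?_,
      endsIn_cut⟩
    have h' := congrFun (congrArg Subtype.val h) (Nat.pair 0 M + 1)
    obtain ⟨a', -, ha'⟩ := hs (Nat.pair 0 M + 1)
    rw [ha'] at h'
    simp [cut_of_lt] at h'

end Ranks

/-! ### Copies of all points near the maximal points -/

section Replacement

variable {b : ℕ}

theorem allowed_iff_of_word {s t : ℕ → Letter} {i : ℕ} {L : Letter} (hs : ∃ a, s i = word a)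
    (ht : ∃ a, t i = word a) (hst : (∀ j ≤ i, (s j).IsLow b) ↔ ∀ j ≤ i, (t j).IsLow b) :
    Allowed b s i L ↔ Allowed b t i L := by
  obtain ⟨a, ha⟩ := hs
  obtain ⟨a', ha'⟩ := ht
  have : index b s i = index b t i := by
    rw [index, index]
    split_ifs <;> tauto
  unfold Allowed
  rw [ha, ha', this]
  cases L <;> rfl

/-- The letters that may follow a letter which is not of the form `word a` do not depend on the
preceding letters. -/
theorem allowed_iff_of_not_word {s t : ℕ → Letter} {i j : ℕ} {L : Letter} (h : s i = t j)
    (hs : ∀ a, s i ≠ word a) : Allowed b s i L ↔ Allowed b t j L := by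
  unfold Allowed
  rw [← h]
  cases h' : s i with
  | word a => exact (hs a h').elim
  | _ => cases L <;> rfl

/-- The sequence `s` with its letters up to position `k` replaced by the letters of `v` up to
position `K`. -/
def replace (v : ℕ → Letter) (K k : ℕ) (s : ℕ → Letter) : ℕ → Letter :=
  fun i => if i ≤ K then v i else s (i + k - K)

theorem replace_of_le {v s : ℕ → Letter} {K k i : ℕ} (h : i ≤ K) : replace v K k s i = v i :=
  if_pos h

theorem replace_of_lt {v s : ℕ → Letter} {K k i : ℕ} (h : K < i) :
    replace v K k s i = s (i + k - K) := if_neg h.not_ge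

theorem continuous_replace (v : ℕ → Letter) (K k : ℕ) : Continuous (replace v K k) := by
  refine continuous_pi fun i => ?_
  by_cases h : i ≤ K
  · simp only [replace_of_le h]; exact continuous_const
  · simp only [replace, if_neg h]; exact continuous_apply _

theorem replace_replace {v w s : ℕ → Letter} {K k : ℕ} (h : ∀ i ≤ k, s i = w i) :
    replace w k K (replace v K k s) = s := by
  funext i
  by_cases hi : i ≤ k
  · rw [replace_of_le hi, h i hi]
  · rw [replace_of_lt (by omega), replace_of_lt (by omega)]
    congr 1
    omega

/-- Replacing initial segments is a local homeomorphism wherever it leads from paths to paths. -/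
theorem locallyHomeomorphic_replace {v w : ℕ → Letter} {K k : ℕ} {A B : Set (ℕ → Letter)}
    (hA : IsClopen A) (hB : IsClopen B) (hAw : ∀ s ∈ A, ∀ i ≤ k, s i = w i)
    (hBv : ∀ s ∈ B, ∀ i ≤ K, s i = v i)
    (hAB : ∀ s ∈ paths b, s ∈ A → replace v K k s ∈ paths b ∧ replace v K k s ∈ B)
    (hBA : ∀ s ∈ paths b, s ∈ B → replace w k K s ∈ paths b ∧ replace w k K s ∈ A)
    (s : paths b) (hs : s.1 ∈ A) :
    EndPair.LocallyHomeomorphic (∅ : Set (paths b)) ⟨replace v K k s.1, (hAB s.1 s.2 hs).1⟩ s := by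
  refine ⟨{t | t.1 ∈ B}, {t | t.1 ∈ A}, hB.preimage continuous_subtype_val,
    hA.preimage continuous_subtype_val, (hAB s.1 s.2 hs).2, hs,
    { toFun := fun t => ⟨⟨replace w k K t.1.1, (hBA t.1.1 t.1.2 t.2).1⟩, (hBA t.1.1 t.1.2 t.2).2⟩
      invFun := fun t => ⟨⟨replace v K k t.1.1, (hAB t.1.1 t.1.2 t.2).1⟩, (hAB t.1.1 t.1.2 t.2).2⟩
      left_inv := fun t => Subtype.ext (Subtype.ext (replace_replace (hBv _ t.2)))
      right_inv := fun t => Subtype.ext (Subtype.ext (replace_replace (hAw _ t.2)))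
      continuous_toFun := ?_
      continuous_invFun := ?_ }, ?_, fun _ => Iff.rfl⟩
  · exact (((continuous_replace w k K).comp
      (continuous_subtype_val.comp continuous_subtype_val)).subtype_mk _).subtype_mk _
  · exact (((continuous_replace v K k).comp
      (continuous_subtype_val.comp continuous_subtype_val)).subtype_mk _).subtype_mk _
  · exact Subtype.ext (Subtype.ext (replace_replace (hAw _ hs)))

theorem isClopen_setOf_eq_prefix (v : ℕ → Letter) (k : ℕ) :
    IsClopen {s : ℕ → Letter | ∀ i ≤ k, s i = v i} :=
  isClopen_setOf_prefix (n := k) _ fun _ _ h hs i hi => (h i hi).symm.trans (hs i hi)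

theorem replace_mem_of_word {v w : ℕ → Letter} {k : ℕ} (hv : ∀ i ≤ k, ∃ a, v i = word a)
    (hw : ∀ i ≤ k, ∃ a, w i = word a)
    (h : (∀ i ≤ k, (v i).IsLow b) ↔ ∀ i ≤ k, (w i).IsLow b) {s : ℕ → Letter} (hs : s ∈ paths b)
    (hsw : ∀ i ≤ k, s i = w i) : replace v k k s ∈ paths b := by
  have hgt : ∀ i > k, replace v k k s i = s i := fun i hi => by
    rw [replace_of_lt hi, Nat.add_sub_cancel]
  have hlow : ∀ i ≥ k, (∀ j ≤ i, (replace v k k s j).IsLow b) ↔ ∀ j ≤ i, (s j).IsLow b := by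
    intro i hi
    constructor
    · intro H j hj
      rcases le_or_gt j k with hjk | hjk
      · rw [hsw j hjk]
        refine h.1 (fun l hl => ?_) j hjk
        have := H l (hl.trans hi)
        rwa [replace_of_le hl] at this
      · exact hgt j hjk ▸ H j hj
    · intro H j hj
      rcases le_or_gt j k with hjk | hjk
      · rw [replace_of_le hjk]
        exact h.2 (fun l hl => hsw l hl ▸ H l (hl.trans hi)) j hjk
      · rw [hgt j hjk]
        exact H j hj
  refine ⟨by rw [replace_of_le (Nat.zero_le k)]; exact hv 0 (Nat.zero_le k), fun i => ?_⟩
  rcases lt_trichotomy i k with hi | rfl | hi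
  · obtain ⟨a, ha⟩ := hv i hi.le
    obtain ⟨a', ha'⟩ := hv (i + 1) hi
    unfold Allowed
    rw [replace_of_le hi.le, replace_of_le (show i + 1 ≤ k from hi), ha, ha']
    trivial
  · rw [hgt _ (Nat.lt_succ_self i)]
    refine (allowed_iff_of_word ?_ ?_ (hlow i le_rfl)).2 (hs.2 i)
    · rw [replace_of_le le_rfl]; exact hv i le_rfl
    · rw [hsw i le_rfl]; exact hw i le_rfl
  · rw [hgt _ (hi.trans (Nat.lt_succ_self i))]
    by_cases hi' : ∃ a, s i = word a
    · exact (allowed_iff_of_word (by rwa [hgt i hi]) hi' (hlow i hi.le)).2 (hs.2 i)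
    · push Not at hi'
      exact (allowed_iff_of_not_word (hgt i hi) (by rwa [hgt i hi])).2 (hs.2 i)

/-- Words of the same length, both or none of them low, have homeomorphic cylinders. -/
theorem locallyHomeomorphic_of_word (s : paths b) {v : ℕ → Letter} {k : ℕ}
    (hv : ∀ i ≤ k, ∃ a, v i = word a) (hs : ∀ i ≤ k, ∃ a, s.1 i = word a)
    (h : (∀ i ≤ k, (v i).IsLow b) ↔ ∀ i ≤ k, (s.1 i).IsLow b) :
    ∃ z : paths b, (∀ i ≤ k, z.1 i = v i) ∧ EndPair.LocallyHomeomorphic ∅ z s :=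
  ⟨_, fun _ hi => replace_of_le hi,
    locallyHomeomorphic_replace (A := {t | ∀ i ≤ k, t i = s.1 i}) (B := {t | ∀ i ≤ k, t i = v i})
      (isClopen_setOf_eq_prefix _ _) (isClopen_setOf_eq_prefix _ _) (fun _ ht => ht)
      (fun _ ht => ht)
      (fun _ ht htA => ⟨replace_mem_of_word hv hs h ht htA, fun _ hi => replace_of_le hi⟩)
      (fun _ ht htB => ⟨replace_mem_of_word hs hv h.symm ht htB, fun _ hi => replace_of_le hi⟩)
      s fun _ _ => rfl⟩

theorem replace_mem_of_centre {v : ℕ → Letter} {K k n : ℕ} (hv : ∀ i ≤ K, ∃ a, v i = word a)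
    (hn : n = index b v K) {s : ℕ → Letter} (hs : s ∈ paths b) (hsk : s (k + 1) = centre n) :
    replace v K k s ∈ paths b := by
  refine ⟨by rw [replace_of_le (Nat.zero_le K)]; exact hv 0 (Nat.zero_le K), fun i => ?_⟩
  rcases lt_trichotomy i K with hi | rfl | hi
  · obtain ⟨a, ha⟩ := hv i hi.le
    obtain ⟨a', ha'⟩ := hv (i + 1) hi
    unfold Allowed
    rw [replace_of_le hi.le, replace_of_le (show i + 1 ≤ K from hi), ha, ha']
    trivial
  · have e : i + 1 + k - i = k + 1 := by omega
    rw [replace_of_lt (Nat.lt_succ_self i), e, hsk]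
    refine (allowed_congr (t := v) fun j hj => replace_of_le hj).2 ?_
    obtain ⟨a, ha⟩ := hv i le_rfl
    unfold Allowed
    rw [ha]
    exact hn
  · have e : i + 1 + k - K = i + k - K + 1 := by omega
    rw [replace_of_lt (hi.trans (Nat.lt_succ_self i)), e]
    refine (allowed_iff_of_not_word (replace_of_lt hi) ?_).2 (hs.2 (i + k - K))
    rw [replace_of_lt hi]
    intro a ha
    obtain ⟨a', ha'⟩ := word_of_le hs (show k + 1 ≤ i + k - K by omega) ⟨a, ha⟩
    simp [hsk] at ha'

/-- The pieces attached to two words of the same index are homeomorphic. -/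
theorem locallyHomeomorphic_of_centre (s : paths b) {v : ℕ → Letter} {K k n : ℕ}
    (hv : ∀ i ≤ K, ∃ a, v i = word a) (hs : ∀ i ≤ k, ∃ a, s.1 i = word a)
    (hvn : n = index b v K) (hsn : n = index b s.1 k) (hsk : s.1 (k + 1) = centre n) :
    ∃ z : paths b, (∀ i ≤ K, z.1 i = v i) ∧ EndPair.LocallyHomeomorphic ∅ z s := by
  have hclopen : ∀ (u : ℕ → Letter) (m : ℕ),
      IsClopen {t : ℕ → Letter | (∀ i ≤ m, t i = u i) ∧ t (m + 1) = centre n} := fun u m =>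
    isClopen_setOf_prefix (n := m + 1) _ fun t t' h ht =>
      ⟨fun i hi => (h i (hi.trans (Nat.le_succ m))).symm.trans (ht.1 i hi),
        (h (m + 1) le_rfl).symm.trans ht.2⟩
  have hnext : ∀ (u t : ℕ → Letter) (l m : ℕ), t (m + 1) = centre n →
      replace u l m t (l + 1) = centre n := fun u t l m ht => by
    rw [replace_of_lt (Nat.lt_succ_self l), ← ht]
    congr 1
    omega
  exact ⟨_, fun _ hi => replace_of_le hi,
    locallyHomeomorphic_replace (hclopen s.1 k) (hclopen v K) (fun _ ht => ht.1)
      (fun _ ht => ht.1)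
      (fun t ht htA => ⟨replace_mem_of_centre hv hvn ht htA.2,
        fun _ hi => replace_of_le hi, hnext v t K k htA.2⟩)
      (fun t ht htB => ⟨replace_mem_of_centre hs hsn ht htB.2,
        fun _ hi => replace_of_le hi, hnext s.1 t k K htB.2⟩)
      s ⟨fun _ _ => rfl, hsk⟩⟩

theorem exists_centre_of_not_word {s : ℕ → Letter} (hs : s ∈ paths b)
    (h : ¬ ∀ i, ∃ a, s i = word a) :
    ∃ k, (∀ i ≤ k, ∃ a, s i = word a) ∧ s (k + 1) = centre (index b s k) := by
  classical
  push Not at h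
  obtain ⟨k, hk⟩ : ∃ k, Nat.find h = k + 1 := by
    refine Nat.exists_eq_succ_of_ne_zero fun h0 => ?_
    obtain ⟨a, ha⟩ := hs.1
    exact Nat.find_spec h a (h0 ▸ ha)
  have hlt : ∀ i ≤ k, ∃ a, s i = word a := fun i hi => by
    by_contra! hcon
    exact Nat.find_min h (m := i) (by omega) hcon
  have hge : ∀ a, s (k + 1) ≠ word a := hk ▸ Nat.find_spec h
  refine ⟨k, hlt, ?_⟩
  obtain ⟨a, ha⟩ := hlt k le_rfl
  have := hs.2 k
  unfold Allowed at this
  split at this <;> simp_all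

/-- Copies of all points are found near every infinite word in low letters. -/
theorem precedes_of_mem_lowPaths (hb : b ≤ 2) (x y : paths b) (hx : x ∈ lowPaths b) :
    EndPair.Precedes ∅ y x := by
  intro U hU
  have hxw : ∀ i, ∃ a, x.1 i = word a := fun i => (hx i).imp fun _ h => h.2
  obtain ⟨M, hM⟩ := eventually_nhds_paths.1 (show ∀ᶠ t in 𝓝 x, t ∈ U from hU)
  by_cases hy : ∀ i, ∃ a, y.1 i = word a
  · by_cases hy' : y ∈ lowPaths b
    · obtain ⟨z, hz, hzy⟩ := locallyHomeomorphic_of_word y (v := x.1) (k := M) (fun i _ => hxw i)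
        (fun i _ => hy i) (iff_of_true (fun i _ => hx i) (fun i _ => hy' i))
      exact ⟨z, hM z hz, hzy⟩
    · obtain ⟨j, hj⟩ : ∃ j, ¬ (y.1 j).IsLow b := by simpa [lowPaths] using hy'
      have hv : cut x.1 M (word 2) (M + 1) = word 2 := cut_of_lt (Nat.lt_succ_self M)
      obtain ⟨z, hz, hzy⟩ := locallyHomeomorphic_of_word y (v := cut x.1 M (word 2))
        (k := max (M + 1) j)
        (fun i _ => by
          rcases le_or_gt i M with h | h
          · rw [cut_of_le h]; exact hxw i
          · rw [cut_of_lt h]; exact ⟨2, rfl⟩)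
        (fun i _ => hy i)
        (iff_of_false (fun h => by
            obtain ⟨a, ha, h'⟩ := h (M + 1) (le_max_left _ _)
            rw [hv, word.injEq] at h'
            subst h'
            simp at ha
            omega)
          fun h => hj (h j (le_max_right _ _)))
      exact ⟨z, hM z fun i hi => (hz i (by omega)).trans (cut_of_le hi), hzy⟩
  · obtain ⟨k, hk, hk'⟩ := exists_centre_of_not_word y.2 hy
    -- the position `K ≥ M` is such that the word `x 0, …, x K` has the index of the piece of `y`
    set K := Nat.pair (index b y.1 k) M with hK
    obtain ⟨z, hz, hzy⟩ := locallyHomeomorphic_of_centre y (v := x.1) (K := K) (fun i _ => hxw i) hk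
      (by rw [index.eq_def b x.1 K, if_pos fun j _ => hx j, hK, Nat.unpair_pair]) rfl hk'
    exact ⟨z, hM z fun i hi => hz i (hi.trans (Nat.right_le_pair _ _)), hzy⟩

theorem isClosed_lowPaths (b : ℕ) : IsClosed (lowPaths b) := by
  have : lowPaths b = ⋂ i, {s : paths b | (s.1 i).IsLow b} := by ext; simp [lowPaths]
  rw [this]
  exact isClosed_iInter fun i => IsClosed.preimage (continuous_letter i)
    (isClosed_discrete {L : Letter | L.IsLow b})

theorem lowPaths_nonempty (hb : 0 < b) : (lowPaths b).Nonempty :=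
  ⟨⟨fun _ => word 0, ⟨0, rfl⟩, fun _ => trivial⟩, fun _ => ⟨0, hb, rfl⟩⟩

theorem maximalPoints_paths (hb₀ : 0 < b) (hb : b ≤ 2) :
    EndPair.maximalPoints (∅ : Set (paths b)) = lowPaths b := by
  ext y
  refine ⟨fun hy => ?_, fun hy x _ => precedes_of_mem_lowPaths hb y x hy⟩
  obtain ⟨x, hx⟩ := lowPaths_nonempty hb₀
  have h := hy x (precedes_of_mem_lowPaths hb x y hx)
  rw [← (isClosed_lowPaths b).closure_eq, mem_closure_iff_nhds]
  intro U hU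
  obtain ⟨z, hzU, hz⟩ := h U hU
  exact ⟨z, hzU, (isCentreLimit_iff hb).1 (hz.isCentreLimit_iff.2 ((isCentreLimit_iff hb).2 hx))⟩

theorem uniqueMaximalType_paths (hb₀ : 0 < b) (hb : b ≤ 2) :
    EndPair.UniqueMaximalType (∅ : Set (paths b)) := by
  rw [EndPair.UniqueMaximalType, maximalPoints_paths hb₀ hb]
  exact ⟨lowPaths_nonempty hb₀, fun x hx y hy =>
    ⟨precedes_of_mem_lowPaths hb y x hy, precedes_of_mem_lowPaths hb x y hx⟩⟩

end Replacement

/-! ### Failure of self-similarity -/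

section Counting

variable {b : ℕ}

/-- The path through the word `c, w 0, …, w (n - 1)` that ends in `centre n`. -/
def centrePath (n : ℕ) (c : Fin 4) (w : Fin n → Fin 4) : ℕ → Letter
  | 0 => word c
  | i + 1 => if h : i < n then word (w ⟨i, h⟩) else centre n

theorem centrePath_mem {n : ℕ} {c : Fin 4} (hc : b ≤ c) (w : Fin n → Fin 4) :
    centrePath n c w ∈ paths b := by
  refine ⟨⟨c, rfl⟩, fun i => ?_⟩
  have hidx : index b (centrePath n c w) i = i := by
    refine if_neg fun h => ?_
    obtain ⟨a, ha, h'⟩ := h 0 (Nat.zero_le i)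
    simp only [centrePath, word.injEq] at h'
    subst h'
    omega
  unfold Allowed
  rw [hidx]
  cases i with
  | zero =>
    by_cases h : 0 < n <;> simp [centrePath, h]
    omega
  | succ i =>
    by_cases h : i < n <;> by_cases h' : i + 1 < n <;> simp [centrePath, h, h'] <;> omega

theorem endsIn_centrePath (n : ℕ) (c : Fin 4) (w : Fin n → Fin 4) :
    EndsIn (centrePath n c w) (centre n) := by
  refine ⟨n + 1, fun i hi => ?_⟩
  obtain ⟨j, rfl⟩ : ∃ j, i = j + 1 := ⟨i - 1, by omega⟩
  simp [centrePath, show ¬ j < n by omega]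

theorem centrePath_injective {n : ℕ} {c c' : Fin 4} {w w' : Fin n → Fin 4}
    (h : centrePath n c w = centrePath n c' w') : c = c' ∧ w = w' := by
  refine ⟨by simpa [centrePath] using congrFun h 0, funext fun i => ?_⟩
  simpa [centrePath] using congrFun h (i + 1)

/-- The space of paths is not homeomorphic to an open set of paths with the same first letter. Such
a homeomorphism would map centres to centres of the same index. For large `n` there are `2 * 4 ^ n`
centres of index `n` on the paths that start with one of the letters `2` and `3`, which are not low,
and at most `4 ^ n` in their image, since centres of index `n` over words of low letters are close
to the maximal points. -/
theorem not_isOpenEmbedding_of_first_letter (hb : b ≤ 2) (a : Fin 4) (f : paths b → paths b)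
    (hf : Topology.IsOpenEmbedding f) (ha : ∀ s, (f s).1 0 = word a) : False := by
  let V : Set (paths b) := {s | ∃ c : Fin 4, 2 ≤ (c : ℕ) ∧ s.1 0 = word c}
  have hV : IsCompact V :=
    (IsClosed.preimage (continuous_letter 0)
      (isClosed_discrete {L : Letter | ∃ c : Fin 4, 2 ≤ (c : ℕ) ∧ L = word c})).isCompact
  -- the compact set `f '' V` is disjoint from the set of maximal points
  obtain ⟨N, hN⟩ : ∃ N, V ⊆ {s | ∃ i ≤ N, ¬ ((f s).1 i).IsLow b} := by
    refine hV.elim_directed_cover (fun N => {s | ∃ i ≤ N, ¬ ((f s).1 i).IsLow b}) ?_ ?_ ?_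
    · intro N
      have : {s | ∃ i ≤ N, ¬ ((f s).1 i).IsLow b} =
          ⋃ i ≤ N, {s | ¬ ((f s).1 i).IsLow b} := by ext; simp
      rw [this]
      refine isOpen_iUnion fun i => isOpen_iUnion fun _ => ?_
      exact (isOpen_discrete {L : Letter | ¬ L.IsLow b}).preimage
        ((continuous_letter i).comp hf.continuous)
    · rintro s ⟨c, hc, hs⟩
      have : f s ∉ lowPaths b := by
        rw [← isCentreLimit_iff hb, hf.isCentreLimit_iff, isCentreLimit_iff hb]
        intro h
        obtain ⟨a', ha', h'⟩ := h 0
        rw [hs, word.injEq] at h'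
        subst h'
        omega
      simp only [lowPaths, Set.mem_ofPred_eq, not_forall] at this
      obtain ⟨i, hi⟩ := this
      exact Set.mem_iUnion.2 ⟨i, i, le_rfl, hi⟩
    · exact directed_of_isDirected_le fun m n hmn s ⟨i, hi, h⟩ => ⟨i, hi.trans hmn, h⟩
  let p : Bool × (Fin N → Fin 4) → paths b := fun q =>
    ⟨centrePath N (bif q.1 then 2 else 3) q.2, centrePath_mem (by cases q.1 <;> simp <;> omega) _⟩
  have hp : Function.Injective p := by
    intro q q' h
    obtain ⟨h₁, h₂⟩ := centrePath_injective (congrArg Subtype.val h)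
    refine Prod.ext ?_ h₂
    revert h₁
    cases q.1 <;> cases q'.1 <;> simp
  have hpV : ∀ q, p q ∈ V := fun q =>
    ⟨bif q.1 then 2 else 3, by cases q.1 <;> simp, rfl⟩
  have hfp : ∀ q, (∀ i ≤ N, ∃ c, (f (p q)).1 i = word c) ∧
      ∀ i > N, (f (p q)).1 i = centre N := by
    intro q
    have h : EndsIn (f (p q)).1 (centre N) := by
      rw [← isCentre_iff hb, hf.isCentre_iff, isCentre_iff hb]
      exact endsIn_centrePath N _ _
    obtain ⟨k, h₁, h₂, hk⟩ := h.exists_index (f (p q)).2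
    suffices N = k by subst this; exact ⟨h₁, h₂⟩
    rw [index] at hk
    split_ifs at hk with hlow
    · obtain ⟨i, hi, hi'⟩ := hN (hpV q)
      have : k < i := by
        by_contra! hle
        exact hi' (hlow i hle)
      have := Nat.unpair_left_le k
      omega
    · exact hk
  choose g hg using fun q => (hfp q).1
  have hinj : Function.Injective fun (q : Bool × (Fin N → Fin 4)) (i : Fin N) =>
      g q (i + 1) i.2 := by
    intro q q' h
    refine hp (hf.injective (Subtype.ext (funext fun i => ?_)))
    rcases Nat.eq_zero_or_pos i with rfl | hi
    · rw [ha, ha]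
    rcases le_or_gt i N with hiN | hiN
    · obtain ⟨j, rfl⟩ : ∃ j, i = j + 1 := ⟨i - 1, by omega⟩
      rw [hg q (j + 1) hiN, hg q' (j + 1) hiN]
      exact congrArg word (congrFun h ⟨j, hiN⟩)
    · rw [(hfp q).2 i hiN, (hfp q').2 i hiN]
  have hcard := Fintype.card_le_of_injective _ hinj
  simp only [Fintype.card_prod, Fintype.card_bool, Fintype.card_pi, Fintype.card_fin,
    Finset.prod_const, Finset.card_univ] at hcard
  have : 0 < 4 ^ N := by positivity
  omega

theorem not_selfSimilar_paths (hb : b ≤ 2) : ¬ EndPair.SelfSimilar (∅ : Set (paths b)) := by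
  intro h
  obtain ⟨a, D, hDa, hD, e, -⟩ := h 3 (fun a => {s | s.1 0 = word a})
    (fun a => (isClopen_discrete {word a}).preimage
      (continuous_letter 0))
    (fun a a' haa' => Set.disjoint_left.2 fun s hs hs' =>
      haa' (word.inj (Eq.trans (Eq.symm hs) hs')))
    (Set.eq_univ_of_forall fun s => by
      obtain ⟨a, ha⟩ := s.2.1
      exact Set.mem_iUnion.2 ⟨a, ha⟩)
  exact not_isOpenEmbedding_of_first_letter hb a (fun s => (e s : paths b))
    (hD.isOpen.isOpenEmbedding_subtypeVal.comp e.isOpenEmbedding) fun s => hDa (e s).2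

end Counting

/-! ### The set of maximal points -/

section LowPaths

theorem lowPaths_one : ∃ x, lowPaths 1 = {x} := by
  obtain ⟨x, hx⟩ := lowPaths_nonempty one_pos
  refine ⟨x, Set.eq_singleton_iff_unique_mem.2 ⟨hx, fun y hy => Subtype.ext (funext fun i => ?_)⟩⟩
  obtain ⟨a, ha, h⟩ := hy i
  obtain ⟨a', ha', h'⟩ := hx i
  rw [h, h', word.injEq, Fin.ext_iff]
  omega

open Classical in
theorem nonempty_lowPaths_two_homeomorph : Nonempty (lowPaths 2 ≃ₜ (ℕ → Bool)) := by
  let φ : lowPaths 2 → ℕ → Bool := fun s i => decide (s.1.1 i = word 1)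
  have hφ : Continuous φ := continuous_pi fun i =>
    (continuous_of_discreteTopology (f := fun L : Letter => decide (L = word 1))).comp
      ((continuous_letter i).comp continuous_subtype_val)
  have hlow : ∀ L : Letter, L.IsLow 2 → L = word (bif decide (L = word 1) then 1 else 0) := by
    rintro L ⟨a, ha, rfl⟩
    obtain rfl | rfl : a = 0 ∨ a = 1 := by omega
    · simp
    · simp
  have hbij : Function.Bijective φ := by
    constructor
    · intro s t h
      refine Subtype.ext (Subtype.ext (funext fun i => ?_))
      rw [hlow _ (s.2 i), hlow _ (t.2 i)]
      have : decide (s.1.1 i = word 1) = decide (t.1.1 i = word 1) := congrFun h i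
      rw [this]
    · intro c
      refine ⟨⟨⟨fun i => word (bif c i then 1 else 0), ⟨_, rfl⟩, fun _ => trivial⟩,
        fun i => ⟨_, ?_, rfl⟩⟩, funext fun i => ?_⟩
      · cases c i <;> simp
      · cases h : c i <;> simp [φ, h]
  have : CompactSpace (lowPaths 2) :=
    isCompact_iff_compactSpace.1 (isClosed_lowPaths 2).isCompact
  exact ⟨hφ.homeoOfEquivCompactToT2 (f := Equiv.ofBijective φ hbij)⟩

end LowPaths

end Letter

/-! ### Ends of complements of totally disconnected sets -/

section Ends

variable {S M : Type*} [TopologicalSpace S] [TopologicalSpace M]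

theorem SurfaceEnd.ext' {e e' : SurfaceEnd S} (h : ∀ C, e.comp C = e'.comp C) : e = e' := by
  cases e; cases e'; congr; exact funext h

theorem SurfaceEnd.isOpen_setOf_comp_eq (C : Compacts S) (D : Set S) :
    IsOpen {e : SurfaceEnd S | e.comp C = D} :=
  isOpen_generateFrom_of_mem ⟨C, D, rfl⟩

instance : T2Space (SurfaceEnd S) := by
  refine ⟨fun e e' hne => ?_⟩
  obtain ⟨C, hC⟩ : ∃ C, e.comp C ≠ e'.comp C := by
    by_contra! h
    exact hne (SurfaceEnd.ext' h)
  refine ⟨_, _, SurfaceEnd.isOpen_setOf_comp_eq C (e.comp C),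
    SurfaceEnd.isOpen_setOf_comp_eq C (e'.comp C), rfl, rfl, ?_⟩
  exact Set.disjoint_left.2 fun f hf hf' => hC (Eq.trans (Eq.symm hf) hf')

/-- If the component that the end `e` chooses in `Cᶜ` meets the preconnected set `A ⊆ Cᶜ`, then it
is the component of each point of `A`. -/
theorem SurfaceEnd.comp_eq (e : SurfaceEnd S) {C : Compacts S} {A : Set S} (hA : IsPreconnected A)
    (hAC : A ⊆ (C : Set S)ᶜ) {x y : S} (hx : x ∈ A) (hxe : x ∈ e.comp C) (hy : y ∈ A) :
    e.comp C = connectedComponentIn (C : Set S)ᶜ y := by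
  obtain ⟨z, -, hze⟩ := e.isComponent C
  rw [hze] at hxe ⊢
  rw [connectedComponentIn_eq hxe]
  exact connectedComponentIn_eq (hA.subset_connectedComponentIn hx hAC hy)

/-- If `S` is the complement of a compact totally disconnected subset `K` of a compact Hausdorff
space `M`, and `K` does not separate `M` locally, then the ends of `S` are the points of `K`. The
space `S` is given through an open embedding `j` into `M`. The end at `p ∈ K` consists of the
components that contain the small punctured neighbourhoods of `p`. -/
theorem nonempty_surfaceEnd_homeomorph [CompactSpace M] [T2Space M] {j : S → M} {K : Set M}
    (hj : Topology.IsOpenEmbedding j) (hjK : Set.range j = Kᶜ) (hK : IsTotallyDisconnected K)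
    (hloc : ∀ p ∈ K, ∀ U ∈ 𝓝 p, ∃ V ∈ 𝓝 p, V ⊆ U ∧ IsConnected (j ⁻¹' V)) :
    Nonempty (SurfaceEnd S ≃ₜ K) := by
  have hKcl : IsClosed K := by
    rw [← isOpen_compl_iff, ← hjK]; exact hj.isOpen_range
  have hKc : CompactSpace K := isCompact_iff_compactSpace.1 hKcl.isCompact
  have hKd : TotallyDisconnectedSpace K :=
    (totallyDisconnectedSpace_subtype_iff).2 hK
  have hjnot : ∀ s, j s ∉ K := fun s => by
    have : j s ∈ Kᶜ := hjK ▸ Set.mem_range_self s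
    exact this
  -- punctured neighbourhoods of `p` that avoid a given compact subset of `S`
  have hnbhd : ∀ (p : K) (C : Compacts S), ∃ V ∈ 𝓝 p.1, IsConnected (j ⁻¹' V) ∧
      j ⁻¹' V ⊆ (C : Set S)ᶜ := by
    intro p C
    have hC : IsClosed (j '' C) := (C.isCompact.image hj.continuous).isClosed
    have hp : p.1 ∉ j '' C := by
      rintro ⟨s, -, hs⟩
      exact hjnot s (hs ▸ p.2)
    obtain ⟨V, hV, hVC, hVc⟩ := hloc p p.2 _ (hC.isOpen_compl.mem_nhds hp)
    exact ⟨V, hV, hVc, fun s hs hsC => hVC hs ⟨s, hsC, rfl⟩⟩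
  choose V hV hVc hVC using hnbhd
  choose x hx using fun p C => (hVc p C).nonempty
  -- the component at `p` does not depend on the choice of the punctured neighbourhood
  have hcomp : ∀ (p : K) (C : Compacts S) (W : Set M), W ∈ 𝓝 p.1 → IsPreconnected (j ⁻¹' W) →
      j ⁻¹' W ⊆ (C : Set S)ᶜ → ∀ w ∈ j ⁻¹' W,
      connectedComponentIn (C : Set S)ᶜ w = connectedComponentIn (C : Set S)ᶜ (x p C) := by
    intro p C W hW hWc hWC w hw
    obtain ⟨V', hV', hVW, hVc'⟩ := hloc p p.2 _ (Filter.inter_mem hW (hV p C))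
    obtain ⟨v, hv⟩ := hVc'.nonempty
    rw [connectedComponentIn_eq (hWc.subset_connectedComponentIn hw hWC (hVW hv).1),
      connectedComponentIn_eq ((hVc p C).isPreconnected.subset_connectedComponentIn (hx p C)
        (hVC p C) (hVW hv).2)]
  let φ : K → SurfaceEnd S := fun p =>
    { comp := fun C => connectedComponentIn (C : Set S)ᶜ (x p C)
      isComponent := fun C => ⟨x p C, hVC p C (hx p C), rfl⟩
      compatible := fun C L hCL => by
        have hsub : (L : Set S)ᶜ ⊆ (C : Set S)ᶜ := Set.compl_subset_compl.2 hCL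
        rw [← hcomp p C (V p L) (hV p L) (hVc p L).isPreconnected ((hVC p L).trans hsub) _ (hx p L)]
        exact connectedComponentIn_mono _ hsub }
  have hcont : Continuous φ := by
    refine continuous_generateFrom_iff.2 ?_
    rintro _ ⟨C, D, rfl⟩
    refine isOpen_iff_mem_nhds.2 fun p hp => ?_
    have : ∀ᶠ q : K in 𝓝 p, V p C ∈ 𝓝 q.1 :=
      (continuous_subtype_val.tendsto p).eventually (eventually_mem_nhds_iff.2 (hV p C))
    filter_upwards [this] with q hq
    have h := hcomp q C (V p C) hq (hVc p C).isPreconnected (hVC p C) _ (hx p C)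
    exact h.symm.trans hp
  have hinj : Function.Injective φ := by
    intro p q hpq
    by_contra hne
    obtain ⟨A, hA, hpA, hqA⟩ := exists_isClopen_of_totally_separated hne
    have hclosed : ∀ B : Set K, IsClosed B → IsClosed (Subtype.val '' B) := fun B hB =>
      (hKcl.isClosedEmbedding_subtypeVal.isClosed_iff_image_isClosed).1 hB
    obtain ⟨U₁, U₂, hU₁, hU₂, hAU₁, hAU₂, hdisj⟩ := normal_separation
      (hclosed A hA.isClosed) (hclosed Aᶜ hA.compl.isClosed)
      ((Set.disjoint_image_iff Subtype.val_injective).2 disjoint_compl_right)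
    have hKU : (U₁ ∪ U₂)ᶜ ⊆ Set.range j := by
      rw [hjK, Set.compl_subset_compl]
      intro k hk
      by_cases h : (⟨k, hk⟩ : K) ∈ A
      · exact Or.inl (hAU₁ ⟨_, h, rfl⟩)
      · exact Or.inr (hAU₂ ⟨_, h, rfl⟩)
    let C : Compacts S := ⟨j ⁻¹' (U₁ ∪ U₂)ᶜ,
      (hj.isInducing.isCompact_preimage_iff hKU).2 (hU₁.union hU₂).isClosed_compl.isCompact⟩
    have hCc : (C : Set S)ᶜ = j ⁻¹' U₁ ∪ j ⁻¹' U₂ := by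
      change (j ⁻¹' (U₁ ∪ U₂)ᶜ)ᶜ = _
      rw [Set.preimage_compl, compl_compl, Set.preimage_union]
    have hd : Disjoint (j ⁻¹' U₁) (j ⁻¹' U₂) := hdisj.preimage j
    have key : ∀ (r : K) (U : Set M), U ∈ 𝓝 r.1 → (j ⁻¹' U ⊆ (C : Set S)ᶜ) →
        ∃ y ∈ j ⁻¹' U, y ∈ (φ r).comp C := by
      intro r U hU hUC
      obtain ⟨W, hW, hWU, hWc⟩ := hloc r r.2 U hU
      obtain ⟨w, hw⟩ := hWc.nonempty
      have hWC := (Set.preimage_mono hWU).trans hUC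
      refine ⟨w, hWU hw, ?_⟩
      change w ∈ connectedComponentIn (C : Set S)ᶜ (x r C)
      rw [← hcomp r C W hW hWc.isPreconnected hWC w hw]
      exact mem_connectedComponentIn (hWC hw)
    obtain ⟨y, hyU, hy⟩ := key p U₁ (hU₁.mem_nhds (hAU₁ ⟨p, hpA, rfl⟩))
      (hCc ▸ Set.subset_union_left)
    obtain ⟨z, hzU, hz⟩ := key q U₂ (hU₂.mem_nhds (hAU₂ ⟨q, hqA, rfl⟩))
      (hCc ▸ Set.subset_union_right)
    rw [← hpq] at hz
    have hpre : IsPreconnected ((φ p).comp C) := isPreconnected_connectedComponentIn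
    have hsub : (φ p).comp C ⊆ j ⁻¹' U₁ ∪ j ⁻¹' U₂ :=
      (connectedComponentIn_subset _ _).trans hCc.subset
    have := hpre.subset_left_of_subset_union (hU₁.preimage hj.continuous)
      (hU₂.preimage hj.continuous) hd hsub ⟨y, hy, hyU⟩ hz
    exact Set.disjoint_left.1 hd this hzU
  have hsurj : Function.Surjective φ := by
    intro e
    have hne : ∀ C, (e.comp C).Nonempty := fun C => by
      obtain ⟨y, hy, h⟩ := e.isComponent C
      exact ⟨y, h ▸ mem_connectedComponentIn hy⟩
    obtain ⟨p, hp⟩ := IsCompact.nonempty_iInter_of_directed_nonempty_isCompact_isClosed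
      (fun C : Compacts S => closure (j '' e.comp C))
      (fun C C' => ⟨C ⊔ C', closure_mono (Set.image_mono (e.compatible _ _ le_sup_left)),
        closure_mono (Set.image_mono (e.compatible _ _ le_sup_right))⟩)
      (fun C => ((hne C).image j).closure) (fun C => isClosed_closure.isCompact)
      fun C => isClosed_closure
    rw [Set.mem_iInter] at hp
    have hpK : p ∈ K := by
      by_contra hpK
      obtain ⟨s, rfl⟩ : p ∈ Set.range j := hjK ▸ hpK
      have : LocallyCompactSpace S := hj.locallyCompactSpace
      obtain ⟨C, hC, hsC⟩ := exists_compact_mem_nhds s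
      obtain ⟨_, h, y, hy, rfl⟩ := mem_closure_iff_nhds.1 (hp ⟨C, hC⟩) _ (hj.image_mem_nhds.2 hsC)
      rw [hj.injective.mem_set_image] at h
      obtain ⟨z, -, hz⟩ := e.isComponent ⟨C, hC⟩
      rw [hz] at hy
      exact connectedComponentIn_subset _ _ hy h
    refine ⟨⟨p, hpK⟩, SurfaceEnd.ext' fun C => ?_⟩
    obtain ⟨_, h, y, hy, rfl⟩ := mem_closure_iff_nhds.1 (hp C) _ (hV ⟨p, hpK⟩ C)
    exact (e.comp_eq (hVc ⟨p, hpK⟩ C).isPreconnected (hVC ⟨p, hpK⟩ C) h hy (hx _ C)).symm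
  exact ⟨(hcont.homeoOfEquivCompactToT2 (f := Equiv.ofBijective φ ⟨hinj, hsurj⟩)).symm⟩

end Ends

/-! ### Planar surfaces and surfaces of finite type -/

section Plane

/-- A convex open subset of the plane stays connected if some, but not all, of its points on a given
horizontal line are removed. -/
theorem isConnected_diff_of_subset_line {U A : Set (EuclideanSpace ℝ (Fin 2))} (hU : IsOpen U)
    (hUc : Convex ℝ U) {h : ℝ} (hA : ∀ z ∈ A, z 1 = h) (hgap : ∃ q ∈ U, q 1 = h ∧ q ∉ A) :
    IsConnected (U \ A) := by
  let G : Set (EuclideanSpace ℝ (Fin 2)) := {z | z ∈ U ∧ z 1 = h ∧ z ∉ A}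
  have hlin : IsLinearMap ℝ fun z : EuclideanSpace ℝ (Fin 2) => z 1 :=
    ⟨fun _ _ => rfl, fun _ _ => rfl⟩
  -- points on the line are limits of points of either open half plane
  have hlim : ∀ z : EuclideanSpace ℝ (Fin 2), ∀ c : ℝ,
      Tendsto (fun t : ℝ => z + t • EuclideanSpace.single 1 c) (𝓝[>] 0) (𝓝 z) := by
    intro z c
    have : Continuous fun t : ℝ => z + t • (EuclideanSpace.single 1 c : EuclideanSpace ℝ (Fin 2))  := by
      fun_prop
    simpa using (this.tendsto 0).mono_left nhdsWithin_le_nhds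
  have hup : G ⊆ closure (U ∩ {z | h < z 1}) := fun z hz => by
    refine hU.inter_closure ⟨hz.1, mem_closure_of_tendsto (hlim z 1) ?_⟩
    filter_upwards [self_mem_nhdsWithin] with t ht
    have ht : 0 < t := ht
    simp [hz.2.1, ht]
  have hdown : G ⊆ closure (U ∩ {z | z 1 < h}) := fun z hz => by
    refine hU.inter_closure ⟨hz.1, mem_closure_of_tendsto (hlim z (-1)) ?_⟩
    filter_upwards [self_mem_nhdsWithin] with t ht
    have ht : 0 < t := ht
    simp [hz.2.1, ht]
  have h₁ : IsPreconnected (U ∩ {z | h < z 1} ∪ G) :=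
    (hUc.inter (convex_halfSpace_gt hlin h)).isPreconnected.subset_closure Set.subset_union_left
      (Set.union_subset subset_closure hup)
  have h₂ : IsPreconnected (U ∩ {z | z 1 < h} ∪ G) :=
    (hUc.inter (convex_halfSpace_lt hlin h)).isPreconnected.subset_closure Set.subset_union_left
      (Set.union_subset subset_closure hdown)
  obtain ⟨q, hqU, hqh, hqA⟩ := hgap
  have hq : q ∈ G := ⟨hqU, hqh, hqA⟩
  have heq : U \ A = (U ∩ {z | h < z 1} ∪ G) ∪ (U ∩ {z | z 1 < h} ∪ G) := by
    ext z
    constructor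
    · rintro ⟨hz, hzA⟩
      rcases lt_trichotomy h (z 1) with hlt | heq | hgt
      · exact Or.inl (Or.inl ⟨hz, hlt⟩)
      · exact Or.inl (Or.inr ⟨hz, heq.symm, hzA⟩)
      · exact Or.inr (Or.inl ⟨hz, hgt⟩)
    · rintro ((⟨hz, hlt⟩ | hz) | (⟨hz, hlt⟩ | hz))
      · exact ⟨hz, fun hzA => (ne_of_gt hlt) (hA z hzA)⟩
      · exact ⟨hz.1, hz.2.2⟩
      · exact ⟨hz, fun hzA => (ne_of_lt hlt) (hA z hzA)⟩
      · exact ⟨hz.1, hz.2.2⟩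
  rw [heq]
  exact ⟨⟨q, Or.inl (Or.inr hq)⟩, h₁.union q (Or.inr hq) (Or.inr hq) h₂⟩

/-- Punctured discs are connected. -/
theorem isConnected_ball_diff_singleton (q : EuclideanSpace ℝ (Fin 2)) {r : ℝ} (hr : 0 < r) :
    IsConnected (Metric.ball q r \ {q}) := by
  refine isConnected_diff_of_subset_line Metric.isOpen_ball (convex_ball q r) (h := q 1)
    (fun z hz => by rw [Set.mem_singleton_iff.1 hz])
    ⟨q + EuclideanSpace.single 0 (r / 2), ?_, ?_, ?_⟩
  · simp [abs_of_pos hr, hr]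
  · simp
  · intro h
    have := congrArg (fun z => z 0) (Set.mem_singleton_iff.1 h)
    simp at this
    exact hr.ne' this

/-- Discs centred on the horizontal axis stay connected if a totally disconnected subset of the axis
is removed. -/
theorem isConnected_ball_diff_of_isTotallyDisconnected {K : Set ℝ} (hK : IsTotallyDisconnected K)
    (c : ℝ) {r : ℝ} (hr : 0 < r) :
    IsConnected (Metric.ball (EuclideanSpace.single 0 c : EuclideanSpace ℝ (Fin 2)) r \
      EuclideanSpace.single 0 '' K) := by
  obtain ⟨x, hx, hxK⟩ : ∃ x ∈ Set.Ioo (c - r) (c + r), x ∉ K := by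
    by_contra! h
    have := hK _ h isPreconnected_Ioo (x := c) (by constructor <;> linarith) (y := c + r / 2)
      (by constructor <;> linarith)
    linarith
  refine isConnected_diff_of_subset_line Metric.isOpen_ball (convex_ball _ r) (h := 0) ?_
    ⟨EuclideanSpace.single 0 x, ?_, by simp, ?_⟩
  · rintro _ ⟨y, -, rfl⟩
    simp
  · rw [Metric.mem_ball, PiLp.dist_single_same, Real.dist_eq, abs_lt]
    constructor <;> linarith [hx.1, hx.2]
  · rintro ⟨y, hy, h⟩
    have := congrArg (fun z => z 0) h
    simp at this
    exact hxK (this ▸ hy)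

end Plane

/-- Surfaces of finite type have finitely many ends. -/
theorem IsFiniteType.finite_surfaceEnd {X : Type*} [TopologicalSpace X] (hX : IsFiniteType X) :
    Finite (SurfaceEnd X) := by
  obtain ⟨M, _, hM, _, F, hF, ⟨h⟩⟩ := hX
  have := hM.t2Space
  have : Finite F := hF
  obtain ⟨A, hcov, -⟩ := hM.oriented_atlas
  have hj : Topology.IsOpenEmbedding fun x => (h x : M) :=
    hF.isClosed.isOpen_compl.isOpenEmbedding_subtypeVal.comp h.isOpenEmbedding
  have hrange : Set.range (fun x => (h x : M)) = Fᶜ := by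
    rw [Set.range_comp' Subtype.val h, h.surjective.range_eq, Set.image_univ, Subtype.range_val]
  refine (nonempty_surfaceEnd_homeomorph hj hrange
    (totallyDisconnectedSpace_subtype_iff.1 inferInstance) ?_).elim
      fun e => Finite.of_equiv _ e.symm.toEquiv
  intro p hp U hU
  obtain ⟨φ, -, hpφ⟩ := hcov p
  -- a chart maps a neighbourhood of `p` that contains no other point of `F` to a disc
  have hW : U ∩ (F \ {p})ᶜ ∈ 𝓝 p :=
    Filter.inter_mem hU ((hF.subset Set.sdiff_subset).isClosed.isOpen_compl.mem_nhds (by simp))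
  have hW' : φ.target ∩ φ.symm ⁻¹' (U ∩ (F \ {p})ᶜ) ∈ 𝓝 (φ p) :=
    Filter.inter_mem (φ.open_target.mem_nhds (φ.map_source hpφ))
      (φ.tendsto_symm hpφ hW)
  obtain ⟨r, hr, hball⟩ := Metric.mem_nhds_iff.1 hW'
  have himage : (fun x => (h x : M)) ''
      ((fun x => (h x : M)) ⁻¹' (φ.symm '' Metric.ball (φ p) r)) =
      φ.symm '' (Metric.ball (φ p) r \ {φ p}) := by
    rw [Set.image_preimage_eq_inter_range, hrange]
    ext y
    constructor
    · rintro ⟨⟨z, hz, rfl⟩, hy⟩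
      refine ⟨z, ⟨hz, ?_⟩, rfl⟩
      rintro rfl
      rw [φ.left_inv hpφ] at hy
      exact hy hp
    · rintro ⟨z, ⟨hz, hzp⟩, rfl⟩
      refine ⟨⟨z, hz, rfl⟩, fun hy => (hball hz).2.2 ⟨hy, fun hyp => hzp ?_⟩⟩
      rw [Set.mem_singleton_iff] at hyp ⊢
      rw [← hyp, φ.right_inv (hball hz).1]
  refine ⟨φ.symm '' Metric.ball (φ p) r, ?_, ?_, ?_⟩
  · have := φ.symm.image_mem_nhds (φ.map_source hpφ) (Metric.ball_mem_nhds (φ p) hr)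
    rwa [φ.left_inv hpφ] at this
  · rintro _ ⟨z, hz, rfl⟩
    exact (hball hz).2.1
  · have hc : IsConnected (φ.symm '' (Metric.ball (φ p) r \ {φ p})) :=
      (isConnected_ball_diff_singleton (φ p) hr).image _
        (φ.continuousOn_symm.mono fun z hz => (hball hz.1).1)
    rw [← himage] at hc
    exact ⟨hc.nonempty.of_image, hj.isInducing.isPreconnected_image.1 hc.isPreconnected⟩

section Planar

/-- A connected open subset of the sphere that omits a point is a surface: the stereographic
projection is a global chart. -/
theorem isSurface_of_isOpenEmbedding {S : Type*} [TopologicalSpace S] [ConnectedSpace S]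
    {j : S → Metric.sphere (0 : EuclideanSpace ℝ (Fin 3)) 1} (hj : Topology.IsOpenEmbedding j)
    {v : Metric.sphere (0 : EuclideanSpace ℝ (Fin 3)) 1} (hv : v ∉ Set.range j) : IsSurface S where
  t2Space := hj.isEmbedding.t2Space
  secondCountable := hj.isEmbedding.secondCountableTopology
  connected := inferInstance
  oriented_atlas := by
    have := Fact.mk (finrank_euclideanSpace_fin (𝕜 := ℝ) (n := 2 + 1))
    let φ : OpenPartialHomeomorph S (EuclideanSpace ℝ (Fin 2)) :=
      (hj.toOpenPartialHomeomorph j).trans (stereographic' 2 v)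
    refine ⟨{φ}, fun x => ⟨φ, rfl, ?_⟩, ?_⟩
    · simp only [φ, OpenPartialHomeomorph.trans_source, stereographic'_source,
        Topology.IsOpenEmbedding.toOpenPartialHomeomorph_source, Set.univ_inter]
      exact fun h => hv ⟨x, h⟩
    · rintro _ rfl _ rfl
      have hid : Set.EqOn (φ.symm.trans φ) id (φ.symm.trans φ).source := fun p hp =>
        by
        simp only [OpenPartialHomeomorph.trans_source, OpenPartialHomeomorph.symm_source] at hp
        exact φ.right_inv hp.1
      refine ⟨contDiffOn_id.congr hid, fun p hp => ?_⟩
      rw [(Filter.eventuallyEq_of_mem ((φ.symm.trans φ).open_source.mem_nhds hp) hid).fderiv_eq,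
        fderiv_id, ContinuousLinearMap.det, ContinuousLinearMap.coe_id, LinearMap.det_id]
      exact one_pos

/-- Every nonempty, compact, totally disconnected space which embeds in the real line is the space
of ends of a planar surface: the complement of a copy of it on a circle in the sphere. -/
theorem exists_planar_surface {E : Type*} [TopologicalSpace E] [CompactSpace E]
    [TotallyDisconnectedSpace E] [Nonempty E] {g : E → ℝ} (hg : Topology.IsEmbedding g) :
    ∃ (S : Type) (_ : TopologicalSpace S), IsSurface S ∧ endsAccumulatedByGenus S = ∅ ∧
      Nonempty (SurfaceEnd S ≃ₜ E) := by
  have := Fact.mk (finrank_euclideanSpace_fin (𝕜 := ℝ) (n := 2 + 1))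
  let Sph := Metric.sphere (0 : EuclideanSpace ℝ (Fin 3)) 1
  obtain ⟨v⟩ : Nonempty Sph :=
    (NormedSpace.sphere_nonempty (x := (0 : EuclideanSpace ℝ (Fin 3))).2 zero_le_one).to_subtype
  let σ : EuclideanSpace ℝ (Fin 2) → Sph := (stereographic' 2 v).symm
  have hσ : Topology.IsOpenEmbedding σ :=
    (stereographic' 2 v).symm.isOpenEmbedding (by simp)
  have hσrange : Set.range σ = {v}ᶜ := by
    rw [← Set.image_univ, ← stereographic'_target v, ← stereographic'_source (n := 2) v]
    exact (stereographic' 2 v).symm_image_target_eq_source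
  have hg' : IsTotallyDisconnected (Set.range g) := hg.isTotallyDisconnected_range.2 inferInstance
  have hι : Topology.IsEmbedding
      (EuclideanSpace.single 0 : ℝ → EuclideanSpace ℝ (Fin 2)) :=
    (Isometry.of_dist_eq fun x y => PiLp.dist_single_same 2 (fun _ => ℝ) _ x y).isEmbedding
  let κ : E → Sph := fun e => σ (EuclideanSpace.single 0 (g e))
  have hκ : Topology.IsEmbedding κ := hσ.isEmbedding.comp (hι.comp hg)
  have hκv : ∀ e, κ e ≠ v := fun e => by
    have : κ e ∈ ({v} : Set Sph)ᶜ := hσrange ▸ Set.mem_range_self _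
    exact this
  let A : Set (EuclideanSpace ℝ (Fin 2)) := EuclideanSpace.single 0 '' Set.range g
  have hκA : ∀ z, σ z ∈ Set.range κ ↔ z ∈ A := by
    intro z
    constructor
    · rintro ⟨e, he⟩
      exact ⟨g e, ⟨e, rfl⟩, hσ.injective he⟩
    · rintro ⟨_, ⟨e, rfl⟩, rfl⟩
      exact ⟨e, rfl⟩
  have hclosed : IsClosed (Set.range κ) := (isCompact_range hκ.continuous).isClosed
  let S := ↥(Set.range κ)ᶜ
  have hj : Topology.IsOpenEmbedding (Subtype.val : S → Sph) :=
    hclosed.isOpen_compl.isOpenEmbedding_subtypeVal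
  have hdiff : ∀ B : Set (EuclideanSpace ℝ (Fin 2)), σ '' B ∩ (Set.range κ)ᶜ = σ '' (B \ A) := by
    intro B
    ext y
    constructor
    · rintro ⟨⟨z, hz, rfl⟩, hy⟩
      exact ⟨z, ⟨hz, fun h => hy ((hκA z).2 h)⟩, rfl⟩
    · rintro ⟨z, ⟨hz, hzA⟩, rfl⟩
      exact ⟨⟨z, hz, rfl⟩, fun h => hzA ((hκA z).1 h)⟩
  -- the plane without `A` is connected and dense in `S`
  have hAc : IsConnected Aᶜ := by
    have h := isConnected_diff_of_subset_line (A := A) isOpen_univ convex_univ (h := 0) ?_ ?_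
    · rwa [← Set.compl_eq_univ_sdiff] at h
    · rintro _ ⟨x, -, rfl⟩
      simp
    · by_contra! h
      have hR : Set.range g = Set.univ := Set.eq_univ_of_forall fun x => by
        obtain ⟨y, hy, hyx⟩ := h (EuclideanSpace.single 0 x) (Set.mem_univ _) (by simp)
        exact hι.injective hyx ▸ hy
      rw [hR] at hg'
      exact zero_ne_one (hg' Set.univ (Set.subset_univ _) isPreconnected_univ (Set.mem_univ (0 : ℝ))
        (Set.mem_univ (1 : ℝ)))
  have hconn : IsConnected (Set.range κ)ᶜ := by
    have hσA : σ '' Aᶜ = {v}ᶜ ∩ (Set.range κ)ᶜ := by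
      rw [← hσrange, ← Set.image_univ, hdiff, Set.compl_eq_univ_sdiff]
    refine (hAc.image σ hσ.continuous.continuousOn).subset_closure
      (hσA ▸ Set.inter_subset_right) fun y hy => ?_
    by_cases hyv : y = v
    · subst hyv
      by_contra hcl
      -- otherwise `v` would be an isolated point of the sphere
      have hopen : IsOpen ({y} : Set Sph) := by
        have : ({y} : Set Sph) = (closure (σ '' Aᶜ))ᶜ ∩ (Set.range κ)ᶜ := by
          refine Set.Subset.antisymm (Set.singleton_subset_iff.2 ⟨hcl, hy⟩) ?_
          rintro z ⟨hz, hzκ⟩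
          by_contra hzy
          exact hz (subset_closure (hσA ▸ ⟨hzy, hzκ⟩))
        rw [this]
        exact isClosed_closure.isOpen_compl.inter hclosed.isOpen_compl
      have : PreconnectedSpace Sph := isPreconnected_iff_preconnectedSpace.1
        (isPreconnected_sphere (by rw [← Module.finrank_eq_rank]; simp) 0 1)
      obtain ⟨e⟩ := ‹Nonempty E›
      have huniv := IsClopen.eq_univ ⟨isClosed_singleton, hopen⟩ ⟨y, rfl⟩
      exact hκv e (Set.mem_singleton_iff.1 (huniv ▸ Set.mem_univ (κ e)))
    · exact subset_closure (hσA ▸ ⟨hyv, hy⟩)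
  have : ConnectedSpace S := isConnected_iff_connectedSpace.1 hconn
  refine ⟨S, inferInstance, ?_, ?_, ?_⟩
  · obtain ⟨e⟩ := ‹Nonempty E›
    exact isSurface_of_isOpenEmbedding hj (v := κ e) (by rw [Subtype.range_val]; simp)
  · refine Set.eq_empty_of_forall_notMem fun e he => he ⊥ ⟨fun u => u.1.1, ?_⟩
    obtain ⟨x, -, hx⟩ := e.isComponent ⊥
    have huniv : e.comp ⊥ = Set.univ := by
      rw [hx, Compacts.coe_bot, Set.compl_empty, connectedComponentIn_univ,
        PreconnectedSpace.connectedComponent_eq_univ]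
    exact hj.comp (huniv ▸ isOpen_univ : IsOpen (e.comp ⊥)).isOpenEmbedding_subtypeVal
  · refine (nonempty_surfaceEnd_homeomorph (K := Set.range κ) hj Subtype.range_val
      (hκ.isTotallyDisconnected_range.2 inferInstance) ?_).map
        fun f => f.trans hκ.toHomeomorph.symm
    rintro _ ⟨e, rfl⟩ U hU
    obtain ⟨r, hr, hball⟩ := Metric.mem_nhds_iff.1 (hσ.continuous.continuousAt hU)
    refine ⟨σ '' Metric.ball (EuclideanSpace.single 0 (g e)) r,
      hσ.image_mem_nhds.2 (Metric.ball_mem_nhds _ hr), Set.image_subset_iff.2 hball, ?_⟩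
    have hc := (isConnected_ball_diff_of_isTotallyDisconnected hg' (g e) hr).image σ
      hσ.continuous.continuousOn
    rw [← hdiff, ← Subtype.range_val (s := (Set.range κ)ᶜ),
      ← Set.image_preimage_eq_inter_range] at hc
    exact ⟨hc.nonempty.of_image, hj.isInducing.isPreconnected_image.1 hc.isPreconnected⟩

end Planar

/-! ### Invariance under homeomorphisms -/

namespace EndPair

variable {E E' : Type*} [TopologicalSpace E] [TopologicalSpace E']

theorem LocallyHomeomorphic.map {x y : E} (h : LocallyHomeomorphic (∅ : Set E) x y)
    (e : E ≃ₜ E') :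
    LocallyHomeomorphic (∅ : Set E') (e x) (e y) := by
  obtain ⟨U, V, hU, hV, hx, hy, f, hf, -⟩ := h
  refine ⟨e '' U, e '' V, ⟨e.isClosed_image.2 hU.1, e.isOpen_image.2 hU.2⟩,
     ⟨e.isClosed_image.2 hV.1, e.isOpen_image.2 hV.2⟩, ⟨x, hx, rfl⟩, ⟨y, hy, rfl⟩,
    (e.image U).symm.trans (f.trans (e.image V)), ?_, fun _ => Iff.rfl⟩
  have : (e.image U).symm ⟨e x, x, hx, rfl⟩ = ⟨x, hx⟩ := (e.image U).symm_apply_apply ⟨x, hx⟩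
  simp only [Homeomorph.trans_apply, this, hf]
  rfl

theorem Precedes.map {x y : E} (h : Precedes (∅ : Set E) x y) (e : E ≃ₜ E') :
    Precedes (∅ : Set E') (e x) (e y) := by
  intro U hU
  obtain ⟨z, hz, hzy⟩ := h (e ⁻¹' U) (e.continuous.continuousAt hU)
  exact ⟨e z, hz, hzy.map e⟩

theorem precedes_map_iff (e : E ≃ₜ E') {x y : E} :
    Precedes (∅ : Set E') (e x) (e y) ↔ Precedes (∅ : Set E) x y :=
  ⟨fun h => by simpa using h.map e.symm, fun h => h.map e⟩

theorem maximalPoints_image (e : E ≃ₜ E') :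
    e '' maximalPoints (∅ : Set E) = maximalPoints (∅ : Set E') := by
  ext y
  obtain ⟨x, rfl⟩ := e.surjective y
  rw [e.injective.mem_set_image]
  simp only [maximalPoints, Set.mem_ofPred_eq, e.surjective.forall, precedes_map_iff]

theorem UniqueMaximalType.map (h : UniqueMaximalType (∅ : Set E)) (e : E ≃ₜ E') :
    UniqueMaximalType (∅ : Set E') := by
  rw [UniqueMaximalType, ← maximalPoints_image e]
  refine ⟨h.1.image e, ?_⟩
  rintro _ ⟨x, hx, rfl⟩ _ ⟨y, hy, rfl⟩
  exact ⟨(h.2 x hx y hy).1.map e, (h.2 x hx y hy).2.map e⟩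

theorem SelfSimilar.map (h : SelfSimilar (∅ : Set E)) (e : E ≃ₜ E') :
    SelfSimilar (∅ : Set E') := by
  intro n P hP hd hu
  obtain ⟨i, D, hD, hDc, f, -⟩ := h n (fun i => e ⁻¹' P i) (fun i => (hP i).preimage e.continuous)
    (fun i j hij => (hd hij).preimage e) (by rw [← Set.preimage_iUnion, hu, Set.preimage_univ])
  exact ⟨i, e '' D, Set.image_subset_iff.2 hD,
    ⟨e.isClosed_image.2 hDc.1, e.isOpen_image.2 hDc.2⟩,
    e.symm.trans (f.trans (e.image D)), fun _ => Iff.rfl⟩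

end EndPair

/-! ### The space of paths as a space of ends -/

namespace Letter

instance : Countable Letter := by
  let code : Letter → (Fin 4 ⊕ ℕ) ⊕ (ℕ ⊕ Bool) := fun L =>
    match L with
    | word a => Sum.inl (Sum.inl a)
    | centre n => Sum.inl (Sum.inr n)
    | rank r => Sum.inr (Sum.inl r)
    | cantor c => Sum.inr (Sum.inr c)
  refine Function.Injective.countable (f := code) fun L L' h => ?_
  cases L <;> cases L' <;> simp_all [code]

open Classical in
theorem exists_isEmbedding_real (b : ℕ) : ∃ g : paths b → ℝ, Topology.IsEmbedding g := by
  have : Nonempty Letter := ⟨word 0⟩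
  obtain ⟨ℓ, hℓ⟩ := exists_surjective_nat Letter
  let φ : paths b → ℕ → Bool := fun s i => decide (s.1 (Nat.unpair i).1 = ℓ (Nat.unpair i).2)
  have hφ : Continuous φ := continuous_pi fun i =>
    (continuous_of_discreteTopology (f := fun L : Letter => decide (L = ℓ (Nat.unpair i).2))).comp
      (continuous_letter _)
  have hinj : Function.Injective φ := fun s t h => Subtype.ext (funext fun i => by
    obtain ⟨n, hn⟩ := hℓ (t.1 i)
    have := congrFun h (Nat.pair i n)
    simpa [φ, hn] using this)
  exact ⟨fun s => cantorSetHomeomorphNatToBool.symm (φ s), Topology.IsEmbedding.subtypeVal.comp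
    (cantorSetHomeomorphNatToBool.symm.isEmbedding.comp
      (hφ.isClosedEmbedding hinj).isEmbedding)⟩

theorem infinite_paths {b : ℕ} (hb : b ≤ 2) : Infinite (paths b) := by
  refine Infinite.of_injective (fun n : ℕ =>
    (⟨centrePath n 3 fun _ => 0, centrePath_mem (by simp; omega) _⟩ : paths b)) fun m n h => ?_
  have hm := endsIn_centrePath m 3 fun _ => 0
  have hn := endsIn_centrePath n 3 fun _ => 0
  rw [show centrePath m 3 (fun _ => 0) = centrePath n 3 fun _ => 0 from congrArg Subtype.val h]
    at hm
  exact centre.inj (hm.unique hn)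

/-- Some planar surface has `paths b` as its space of ends, and then its maximal ends are the
infinite words in the `b` low letters. -/
theorem exists_surface {b : ℕ} (hb₀ : 0 < b) (hb : b ≤ 2) :
    ∃ (S : Type) (_ : TopologicalSpace S), IsInfiniteTypeSurface S ∧
      ¬ EndPair.SelfSimilar (endsAccumulatedByGenus S) ∧
      EndPair.UniqueMaximalType (endsAccumulatedByGenus S) ∧
      ∃ e : paths b ≃ₜ SurfaceEnd S,
        EndPair.maximalPoints (endsAccumulatedByGenus S) = e '' lowPaths b := by
  have := infinite_paths hb
  have : TotallyDisconnectedSpace (paths b) := inferInstance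
  obtain ⟨g, hg⟩ := exists_isEmbedding_real b
  obtain ⟨S, _, hS, hG, ⟨e⟩⟩ := exists_planar_surface hg
  refine ⟨S, inferInstance, ⟨hS, fun hfin => ?_⟩, ?_, ?_, e.symm, ?_⟩
  · have := hfin.finite_surfaceEnd
    exact not_finite_iff_infinite.2 ‹_› (Finite.of_equiv _ e.toEquiv)
  · rw [hG]
    exact fun h => not_selfSimilar_paths hb (h.map e)
  · rw [hG]
    exact (uniqueMaximalType_paths hb₀ hb).map e.symm
  · rw [hG, ← EndPair.maximalPoints_image e.symm, maximalPoints_paths hb₀ hb]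

end Letter

theorem theorem1 :
    (∃ (S : Type) (_ : TopologicalSpace S), IsInfiniteTypeSurface S ∧
      ¬ EndPair.SelfSimilar (endsAccumulatedByGenus S) ∧
      EndPair.UniqueMaximalType (endsAccumulatedByGenus S) ∧
      ∃ x : SurfaceEnd S, EndPair.maximalPoints (endsAccumulatedByGenus S) = {x}) ∧
    (∃ (S : Type) (_ : TopologicalSpace S), IsInfiniteTypeSurface S ∧
      ¬ EndPair.SelfSimilar (endsAccumulatedByGenus S) ∧
      EndPair.UniqueMaximalType (endsAccumulatedByGenus S) ∧
      Nonempty (EndPair.maximalPoints (endsAccumulatedByGenus S) ≃ₜ cantorSet)) := by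
  constructor
  · obtain ⟨S, _, hS, hns, hu, e, he⟩ := Letter.exists_surface one_pos one_le_two
    obtain ⟨x, hx⟩ := Letter.lowPaths_one
    exact ⟨S, inferInstance, hS, hns, hu, e x, by rw [he, hx, Set.image_singleton]⟩
  · obtain ⟨S, _, hS, hns, hu, e, he⟩ := Letter.exists_surface two_pos le_rfl
    obtain ⟨f⟩ := Letter.nonempty_lowPaths_two_homeomorph
    refine ⟨S, inferInstance, hS, hns, hu, ?_⟩
    rw [he]
    exact ⟨(e.image _).symm.trans (f.trans cantorSetHomeomorphNatToBool.symm)⟩
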